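/- Let $(\mathcal C;\mathcal E)$ and $(\mathcal D;\mathcal E')$ be weakly idempotent complete (Quillen) exact categories, let $\mathrm q:\mathcal C\to\mathcal D$ be left adjoint to $\mathrm t:\mathcal D\to\mathcal C$, with unit $\eta$ and counit $\xi$, and let $\operatorname{Ext}^k$ ($k\ge 1$) denote the Yoneda extension groups: the abelian groups (under Baer sum) of classes of exact sequences $A\rightarrowtail B_k\to\cdots\to B_1\twoheadrightarrow X$, modulo the equivalence relation generated by the morphisms of exact sequences that are identities on $A$ and $X$. When $\mathcal C$ or $\mathcal D$ is assumed abelian, it carries its standard exact structure of all short exact sequences. If $\mathrm t$ is exact, let $$\Theta^k_{CD}:\operatorname{Ext}^k(\mathrm q(C),D)\to\operatorname{Ext}^k(C,\mathrm t(D)),\qquad \mathbb E\mapsto \mathrm t(\mathbb E)\,\eta_C,$$ be the homomorphism that applies $\mathrm t$ and pulls back along $\eta_C$; if $\mathrm q$ is exact, let $$\Omega^k_{CD}:\operatorname{Ext}^k(C,\mathrm t(D))\to\operatorname{Ext}^k(\mathrm q(C),D),\qquad \mathbb E\mapsto \xi_D\,\mathrm q(\mathbb E),$$ be the homomorphism that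 applies $\mathrm q$ and pushes out along $\xi_D$. Let $n\ge 1$, $C\in\mathcal C$ and $D\in\mathcal D$. (i) Suppose that $\mathrm t$ is exact, that $\mathcal D$ is abelian, and that $\mathcal F$ is a class of objects of $\mathcal C$ which is closed under extensions, is generating (every object $A$ of $\mathcal C$ admits an admissible epic $F\twoheadrightarrow A$ with $F\in\mathcal F$), is closed under kernels of admissible epics between objects of $\mathcal F$, and is such that $\mathrm q$ preserves short exact sequences with all terms in $\mathcal F$. Let $\mathrm L_k^{\mathcal F}\mathrm q(C)=\mathrm H_k(\mathrm q(F_*))$ be the relative left derived functors, where $F_*$ is any $\mathcal F$-resolution of $C$, i.e. the deleted complex of an exact sequence $\cdots\to F_1\to F_0\twoheadrightarrow C$ with all $F_i\in\mathcal F$. Then the following are equivalent: (a) $\mathrm L_k^{\mathcal F}\mathrm q(C)=0$ for every $1\le k\le n$; (b) for every $1\le k\le n$ the natural transformation $\Theta^k_C:\operatorname{Ext}^k(\mathrm q(C),-)\Rightarrow\operatorname{Ext}^k(C,\mathrm t(-))$ is an isomorphism. (ii) Suppose that $\mathrm q$ is exact, that $\mathcal C$ is abelian, and that $\mathcal G$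 is a class of objects of $\mathcal D$ which is closed under extensions, is cogenerating (every object $A$ of $\mathcal D$ admits an admissible monic $A\rightarrowtail G$ with $G\in\mathcal G$), is closed under cokernels of admissible monics between objects of $\mathcal G$, and is such that $\mathrm t$ preserves short exact sequences with all terms in $\mathcal G$. Let $\mathrm R^k_{\mathcal G}\mathrm t(D)=\mathrm H^k(\mathrm t(G^*))$ be the relative right derived functors, where $G^*$ is any $\mathcal G$-coresolution of $D$, i.e. the deleted complex of an exact sequence $D\rightarrowtail G^0\to G^1\to\cdots$ with all $G^i\in\mathcal G$. Then the following are equivalent: (a) $\mathrm R^k_{\mathcal G}\mathrm t(D)=0$ for every $1\le k\le n$; (b) for every $1\le k\le n$ the natural transformation $\Omega^k_D:\operatorname{Ext}^k(-,\mathrm t(D))\Rightarrow\operatorname{Ext}^k(\mathrm q(-),D)$ is an isomorphism. -/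

import Mathlib

open CategoryTheory CategoryTheory.Limits
open scoped ZeroObject

set_option linter.unusedSectionVars false

universe v v' u u'

namespace ExactCat

section Exact

variable {C : Type u} [Category.{v} C] [Preadditive C]

/-- `i` is the first map of a member of the class `P` of short complexes. -/
def IsAdmissibleMono (P : ObjectProperty (ShortComplex C)) {X Y : C} (i : X ⟶ Y) : Prop :=
  ∃ (Z : C) (p : Y ⟶ Z) (w : i ≫ p = 0), P (ShortComplex.mk i p w)

/-- `p` is the second map of a member of the class `P` of short complexes. -/
def IsAdmissibleEpi (P : ObjectProperty (ShortComplex C)) {Y Z : C} (p : Y ⟶ Z) : Prop :=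
  ∃ (X : C) (i : X ⟶ Y) (w : i ≫ p = 0), P (ShortComplex.mk i p w)

/-- A (Quillen) exact structure on an additive category: an isomorphism-closed class `conf` of
kernel-cokernel pairs (the short exact sequences of the structure) such that identities are
admissible monics and admissible epics, both classes are closed under composition, and
pushouts of admissible monics and pullbacks of admissible epics along arbitrary morphisms exist
and are again admissible. -/
structure ExactStructure (C : Type u) [Category.{v} C] [Preadditive C] where
  /-- the class of short exact sequences -/
  conf : ObjectProperty (ShortComplex C)
  conf_of_iso : ∀ {S T : ShortComplex C}, (S ≅ T) → conf S → conf T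
  isKernel : ∀ S, conf S → Nonempty (IsLimit (KernelFork.ofι S.f S.zero))
  isCokernel : ∀ S, conf S → Nonempty (IsColimit (CokernelCofork.ofπ S.g S.zero))
  mono_id : ∀ X : C, IsAdmissibleMono conf (𝟙 X)
  epi_id : ∀ X : C, IsAdmissibleEpi conf (𝟙 X)
  mono_comp : ∀ {X Y Z : C} (i : X ⟶ Y) (j : Y ⟶ Z),
    IsAdmissibleMono conf i → IsAdmissibleMono conf j → IsAdmissibleMono conf (i ≫ j)
  epi_comp : ∀ {X Y Z : C} (p : X ⟶ Y) (q : Y ⟶ Z),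
    IsAdmissibleEpi conf p → IsAdmissibleEpi conf q → IsAdmissibleEpi conf (p ≫ q)
  pushout : ∀ {X Y X' : C} (i : X ⟶ Y) (f : X ⟶ X'), IsAdmissibleMono conf i →
    ∃ (Y' : C) (g : Y ⟶ Y') (i' : X' ⟶ Y'), IsPushout i f g i' ∧ IsAdmissibleMono conf i'
  pullback : ∀ {Y Z Z' : C} (p : Y ⟶ Z) (f : Z' ⟶ Z), IsAdmissibleEpi conf p →
    ∃ (Y' : C) (g : Y' ⟶ Y) (p' : Y' ⟶ Z'), IsPullback g p' p f ∧ IsAdmissibleEpi conf p'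

/-- Weak idempotent completeness: every retraction has a kernel. -/
def WeaklyIdempotentComplete (C : Type u) [Category.{v} C] [Preadditive C] : Prop :=
  ∀ ⦃X Y : C⦄ (r : X ⟶ Y) (s : Y ⟶ X), s ≫ r = 𝟙 Y → HasKernel r

namespace ExactStructure

variable (E : ExactStructure C)

lemma exists_desc {X Y Z : C} {i : X ⟶ Y} {p : Y ⟶ Z} {w : i ≫ p = 0}
    (h : E.conf (ShortComplex.mk i p w)) {T : C} (k : Y ⟶ T) (hk : i ≫ k = 0) :
    ∃ l : Z ⟶ T, p ≫ l = k := by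
  obtain ⟨hc⟩ := E.isCokernel _ h
  exact ⟨_, (CokernelCofork.IsColimit.desc' hc k hk).2⟩

lemma exists_lift {X Y Z : C} {i : X ⟶ Y} {p : Y ⟶ Z} {w : i ≫ p = 0}
    (h : E.conf (ShortComplex.mk i p w)) {T : C} (k : T ⟶ Y) (hk : k ≫ p = 0) :
    ∃ l : T ⟶ X, l ≫ i = k := by
  obtain ⟨hc⟩ := E.isKernel _ h
  exact ⟨_, (KernelFork.IsLimit.lift' hc k hk).2⟩

lemma epi_of_conf {X Y Z : C} {i : X ⟶ Y} {p : Y ⟶ Z} {w : i ≫ p = 0}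
    (h : E.conf (ShortComplex.mk i p w)) : Epi p := by
  obtain ⟨hc⟩ := E.isCokernel _ h
  exact ⟨fun _ _ e => Cofork.IsColimit.hom_ext hc e⟩

lemma mono_of_conf {X Y Z : C} {i : X ⟶ Y} {p : Y ⟶ Z} {w : i ≫ p = 0}
    (h : E.conf (ShortComplex.mk i p w)) : Mono i := by
  obtain ⟨hc⟩ := E.isKernel _ h
  exact ⟨fun _ _ e => Fork.IsLimit.hom_ext hc e⟩

lemma conf_of_isCokernel {X Y Z : C} {i : X ⟶ Y} (hi : IsAdmissibleMono E.conf i) {p : Y ⟶ Z}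
    (w : i ≫ p = 0) [Epi p]
    (hp : ∀ {T : C} (k : Y ⟶ T), i ≫ k = 0 → ∃ l : Z ⟶ T, p ≫ l = k) :
    E.conf (ShortComplex.mk i p w) := by
  obtain ⟨Z', p', w', h⟩ := hi
  have := E.epi_of_conf h
  obtain ⟨l, hl⟩ := hp p' w'
  obtain ⟨m, hm⟩ := E.exists_desc h p w
  exact E.conf_of_iso (ShortComplex.isoMk (S₁ := ShortComplex.mk i p' w')
    (S₂ := ShortComplex.mk i p w) (Iso.refl _) (Iso.refl _)
    ⟨m, l, by simp [← cancel_epi p', reassoc_of% hm, hl],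
      by simp [← cancel_epi p, reassoc_of% hl, hm]⟩ (by simp) (by simp [hm])) h

lemma conf_of_isKernel {X Y Z : C} {p : Y ⟶ Z} (hp : IsAdmissibleEpi E.conf p) {i : X ⟶ Y}
    (w : i ≫ p = 0) [Mono i]
    (hi : ∀ {T : C} (k : T ⟶ Y), k ≫ p = 0 → ∃ l : T ⟶ X, l ≫ i = k) :
    E.conf (ShortComplex.mk i p w) := by
  obtain ⟨X', i', w', h⟩ := hp
  have := E.mono_of_conf h
  obtain ⟨l, hl⟩ := hi i' w'
  obtain ⟨m, hm⟩ := E.exists_lift h i w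
  exact E.conf_of_iso (ShortComplex.isoMk (S₁ := ShortComplex.mk i' p w')
    (S₂ := ShortComplex.mk i p w) ⟨l, m, by simp [← cancel_mono i', hm, hl],
      by simp [← cancel_mono i, hl, hm]⟩ (Iso.refl _) (Iso.refl _) (by simp [hl]) (by simp)) h

lemma conf_pushout {X Y Z X' Y' : C} {i : X ⟶ Y} {p : Y ⟶ Z} {w : i ≫ p = 0}
    (h : E.conf (ShortComplex.mk i p w)) {f : X ⟶ X'} {g : Y ⟶ Y'} {i' : X' ⟶ Y'}
    (sq : IsPushout i f g i') (hi' : IsAdmissibleMono E.conf i') :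
    ∃ (p' : Y' ⟶ Z) (w' : i' ≫ p' = 0), g ≫ p' = p ∧ E.conf (ShortComplex.mk i' p' w') := by
  have := E.epi_of_conf h
  have hw : i ≫ p = f ≫ (0 : X' ⟶ Z) := by simp [w]
  have : Epi (sq.desc p 0 hw) := by
    have : Epi (g ≫ sq.desc p 0 hw) := by simpa
    exact epi_of_epi g _
  refine ⟨sq.desc p 0 hw, by simp, by simp, E.conf_of_isCokernel hi' _ fun k hk => ?_⟩
  obtain ⟨l, hl⟩ := E.exists_desc h (g ≫ k) (by rw [sq.w_assoc, hk, comp_zero])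
  exact ⟨l, sq.hom_ext (by simp [hl]) (by simp [hk])⟩

lemma conf_pullback {X Y Z Y' Z' : C} {i : X ⟶ Y} {p : Y ⟶ Z} {w : i ≫ p = 0}
    (h : E.conf (ShortComplex.mk i p w)) {f : Z' ⟶ Z} {g : Y' ⟶ Y} {p' : Y' ⟶ Z'}
    (sq : IsPullback g p' p f) (hp' : IsAdmissibleEpi E.conf p') :
    ∃ (i' : X ⟶ Y') (w' : i' ≫ p' = 0), i' ≫ g = i ∧ E.conf (ShortComplex.mk i' p' w') := by
  have := E.mono_of_conf h
  have hw : i ≫ p = (0 : X ⟶ Z') ≫ f := by simp [w]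
  have : Mono (sq.lift i 0 hw) := by
    have : Mono (sq.lift i 0 hw ≫ g) := by simpa
    exact mono_of_mono _ g
  refine ⟨sq.lift i 0 hw, by simp, by simp, E.conf_of_isKernel hp' _ fun k hk => ?_⟩
  obtain ⟨l, hl⟩ := E.exists_lift h (k ≫ g)
    (by rw [Category.assoc, sq.w, reassoc_of% hk, zero_comp])
  exact ⟨l, sq.hom_ext (by simp [hl]) (by simp [hk])⟩

lemma mono_of_isPushout {X Y X' Y' : C} {i : X ⟶ Y} (hi : IsAdmissibleMono E.conf i)
    {f : X ⟶ X'} {g : Y ⟶ Y'} {i' : X' ⟶ Y'} (sq : IsPushout i f g i') :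
    IsAdmissibleMono E.conf i' := by
  obtain ⟨Y₁, g₁, i₁, sq₁, Z, p, w, h⟩ := E.pushout i f hi
  have e := IsPushout.inr_isoIsPushout_inv (h := sq₁) (h' := sq)
  have e' := IsPushout.inr_isoIsPushout_hom (h := sq₁) (h' := sq)
  refine ⟨Z, (sq₁.isoIsPushout _ _ sq).inv ≫ p, by rw [reassoc_of% e, w], ?_⟩
  exact E.conf_of_iso (ShortComplex.isoMk (S₁ := ShortComplex.mk i₁ p w)
    (Iso.refl _) (sq₁.isoIsPushout _ _ sq) (Iso.refl _) (by simp) (by simp)) h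

variable [HasBinaryBiproducts C]

lemma conf_biprod {X Y Z X' Y' Z' : C} {i : X ⟶ Y} {p : Y ⟶ Z} {w : i ≫ p = 0}
    (h : E.conf (ShortComplex.mk i p w)) {i' : X' ⟶ Y'} {p' : Y' ⟶ Z'} {w' : i' ≫ p' = 0}
    (h' : E.conf (ShortComplex.mk i' p' w')) (w'' : biprod.map i i' ≫ biprod.map p p' = 0) :
    E.conf (ShortComplex.mk (biprod.map i i') (biprod.map p p') w'') := by
  have sq₁ : IsPushout i biprod.inl biprod.inl (biprod.map i (𝟙 X')) := by
    refine ⟨⟨by simp⟩, ⟨PushoutCocone.IsColimit.mk _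
      (fun s => biprod.desc s.inl (biprod.inr ≫ s.inr)) (by simp) (fun s => ?_)
      (fun s m h₁ h₂ => ?_)⟩⟩
    · ext <;> simp [s.condition]
    · ext
      · simpa using h₁
      · simp [← h₂]
  have sq₂ : IsPushout i' biprod.inr biprod.inr (biprod.map (𝟙 Y) i') := by
    refine ⟨⟨by simp⟩, ⟨PushoutCocone.IsColimit.mk _
      (fun s => biprod.desc (biprod.inl ≫ s.inr) s.inl) (by simp) (fun s => ?_)
      (fun s m h₁ h₂ => ?_)⟩⟩
    · ext <;> simp [s.condition]
    · ext
      · simp [← h₂]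
      · simpa using h₁
  have hm : IsAdmissibleMono E.conf (biprod.map i i') := by
    have e : biprod.map i i' = biprod.map i (𝟙 X') ≫ biprod.map (𝟙 Y) i' := by ext <;> simp
    rw [e]
    exact E.mono_comp _ _ (E.mono_of_isPushout ⟨_, _, _, h⟩ sq₁)
      (E.mono_of_isPushout ⟨_, _, _, h'⟩ sq₂)
  have := E.epi_of_conf h
  have := E.epi_of_conf h'
  have : Epi (biprod.map p p') := by
    refine ⟨fun a b e => ?_⟩
    ext
    · have := biprod.inl ≫= e
      simpa [cancel_epi] using this
    · have := biprod.inr ≫= e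
      simpa [cancel_epi] using this
  refine E.conf_of_isCokernel hm _ fun k hk => ?_
  obtain ⟨l, hl⟩ := E.exists_desc h (biprod.inl ≫ k) (by simpa using biprod.inl ≫= hk)
  obtain ⟨l', hl'⟩ := E.exists_desc h' (biprod.inr ≫ k) (by simpa using biprod.inr ≫= hk)
  exact ⟨biprod.desc l l', by ext <;> simp [hl, hl']⟩

variable [HasZeroObject C]

lemma conf_split (X A : C) :
    E.conf (ShortComplex.mk (biprod.inl : A ⟶ A ⊞ X) biprod.snd (by simp)) := by
  have h0 : IsAdmissibleMono E.conf (0 : (0 : C) ⟶ X) := by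
    obtain ⟨K, i, w, h⟩ := E.epi_id X
    have : Mono (0 : (0 : C) ⟶ X) := ⟨fun _ _ _ => (isZero_zero C).eq_of_tgt _ _⟩
    exact ⟨X, 𝟙 X, by simp, E.conf_of_isKernel ⟨K, i, w, h⟩ _ fun k hk => ⟨0, by
      simpa using hk.symm⟩⟩
  have sq : IsPushout (0 : (0 : C) ⟶ X) (0 : (0 : C) ⟶ A) biprod.inr (biprod.inl : A ⟶ A ⊞ X) :=
    (IsPushout.of_has_biproduct A X).flip
  exact E.conf_of_isCokernel (E.mono_of_isPushout h0 sq) _ fun k hk =>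
    ⟨biprod.inr ≫ k, by ext <;> simp [hk]⟩

end ExactStructure

/-! ### Yoneda extensions -/

/-- A short exact sequence `A ⟶ B ⟶ X` with prescribed end terms. -/
structure Extension (E : ExactStructure C) (X A : C) where
  B : C
  i : A ⟶ B
  p : B ⟶ X
  w : i ≫ p = 0
  conf : E.conf (ShortComplex.mk i p w)

variable {E : ExactStructure C}

/-- There is a morphism of short exact sequences with end components `a` and `c`. -/
def Extension.Mor {X A X' A' : C} (S : Extension E X A) (T : Extension E X' A')
    (a : A ⟶ A') (c : X ⟶ X') : Prop :=
  ∃ b : S.B ⟶ T.B, S.i ≫ b = a ≫ T.i ∧ S.p ≫ c = b ≫ T.p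

/-- `ExtSeq E m X A` is the type of exact sequences
`A ⟶ B_{m+1} ⟶ ⋯ ⟶ B_1 ⟶ X` with `m + 1` middle terms, each presented as the splice of `m + 1`
short exact sequences: for `m = 0` a short exact sequence, for `m + 1` an object `Z`, an exact
sequence from `A` to `Z` with `m + 1` middle terms and a short exact sequence `Z ⟶ B_1 ⟶ X`. -/
def ExtSeq (E : ExactStructure C) : ℕ → C → C → Type (max u v)
  | 0, X, A => Extension E X A
  | m + 1, X, A => Σ Z : C, ExtSeq E m Z A × Extension E X Z

/-- There is a morphism of exact sequences with end components `a` and `c`. (The maps on the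
middle terms induce the maps `z` on the intermediate objects.) -/
def ExtSeq.Mor : ∀ {m : ℕ} {X A X' A' : C}, ExtSeq E m X A → ExtSeq E m X' A' →
    (A ⟶ A') → (X ⟶ X') → Prop
  | 0, _, _, _, _, S, T, a, c => Extension.Mor S T a c
  | _ + 1, _, _, _, _, S, T, a, c =>
    ∃ z : S.1 ⟶ T.1, ExtSeq.Mor S.2.1 T.2.1 a z ∧ Extension.Mor S.2.2 T.2.2 z c

/-- The Yoneda extension group `Ext^{m+1}(X, A)`: exact sequences with `m + 1` middle terms
modulo the equivalence relation generated by the morphisms which are identities on both ends. -/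
def ExtSucc (E : ExactStructure C) (m : ℕ) (X A : C) : Type (max u v) :=
  Quot fun S T : ExtSeq E m X A => S.Mor T (𝟙 A) (𝟙 X)

/-- The class of an exact sequence. -/
def ExtSeq.cls {m : ℕ} {X A : C} (S : ExtSeq E m X A) : ExtSucc E m X A := Quot.mk _ S

namespace Extension

lemma Mor.id {X A : C} (S : Extension E X A) : S.Mor S (𝟙 A) (𝟙 X) := ⟨𝟙 _, by simp, by simp⟩

lemma Mor.comp {X A X' A' X'' A'' : C} {S : Extension E X A} {T : Extension E X' A'}
    {U : Extension E X'' A''} {a : A ⟶ A'} {c : X ⟶ X'} {a' : A' ⟶ A''} {c' : X' ⟶ X''}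
    (h : S.Mor T a c) (h' : T.Mor U a' c') : S.Mor U (a ≫ a') (c ≫ c') := by
  obtain ⟨b, h₁, h₂⟩ := h
  obtain ⟨b', h₁', h₂'⟩ := h'
  exact ⟨b ≫ b', by simp [reassoc_of% h₁, h₁'], by simp [reassoc_of% h₂, h₂']⟩

lemma exists_pushout {X A A' : C} (S : Extension E X A) (a : A ⟶ A') :
    ∃ S' : Extension E X A', S.Mor S' a (𝟙 X) ∧
      ∀ {X' : C} (T : Extension E X' A') (c : X ⟶ X'), S.Mor T a c → S'.Mor T (𝟙 A') c := by
  obtain ⟨B', g, i', sq, hi'⟩ := E.pushout S.i a ⟨_, _, _, S.conf⟩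
  obtain ⟨p', w', hg, h⟩ := E.conf_pushout S.conf sq hi'
  refine ⟨⟨B', i', p', w', h⟩, ⟨g, sq.w, by simp [hg]⟩, ?_⟩
  rintro X' T c ⟨b, h₁, h₂⟩
  refine ⟨sq.desc b T.i h₁, by simp, sq.hom_ext ?_ ?_⟩
  · simp [reassoc_of% hg, h₂]
  · simp [reassoc_of% w', T.w]

lemma exists_pullback {X A X' : C} (S : Extension E X A) (c : X' ⟶ X) :
    ∃ S' : Extension E X' A, S'.Mor S (𝟙 A) c ∧
      ∀ {A' : C} (T : Extension E X' A') (a : A' ⟶ A), T.Mor S a c → T.Mor S' a (𝟙 X') := by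
  obtain ⟨B', g, p', sq, hp'⟩ := E.pullback S.p c ⟨_, _, _, S.conf⟩
  obtain ⟨i', w', hg, h⟩ := E.conf_pullback S.conf sq hp'
  refine ⟨⟨B', i', p', w', h⟩, ⟨g, by simp [hg], sq.w.symm⟩, ?_⟩
  rintro A' T a ⟨b, h₁, h₂⟩
  refine ⟨sq.lift b T.p h₂.symm, sq.hom_ext ?_ ?_, by simp⟩
  · simp [hg, h₁]
  · simp [w', T.w]

end Extension

namespace ExtSeq

lemma Mor.id : ∀ {m : ℕ} {X A : C} (S : ExtSeq E m X A), S.Mor S (𝟙 A) (𝟙 X)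
  | 0, _, _, S => Extension.Mor.id S
  | _ + 1, _, _, S => ⟨𝟙 _, Mor.id S.2.1, Extension.Mor.id S.2.2⟩

lemma Mor.comp : ∀ {m : ℕ} {X A X' A' X'' A'' : C} {S : ExtSeq E m X A} {T : ExtSeq E m X' A'}
    {U : ExtSeq E m X'' A''} {a : A ⟶ A'} {c : X ⟶ X'} {a' : A' ⟶ A''} {c' : X' ⟶ X''},
    S.Mor T a c → T.Mor U a' c' → S.Mor U (a ≫ a') (c ≫ c')
  | 0, _, _, _, _, _, _, _, _, _, _, _, _, _, h, h' => Extension.Mor.comp h h'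
  | _ + 1, _, _, _, _, _, _, _, _, _, _, _, _, _, ⟨_, h₁, h₂⟩, ⟨_, h₁', h₂'⟩ =>
    ⟨_, Mor.comp h₁ h₁', Extension.Mor.comp h₂ h₂'⟩

lemma exists_pushout : ∀ {m : ℕ} {X A A' : C} (S : ExtSeq E m X A) (a : A ⟶ A'),
    ∃ S' : ExtSeq E m X A', S.Mor S' a (𝟙 X) ∧
      ∀ {X' : C} (T : ExtSeq E m X' A') (c : X ⟶ X'), S.Mor T a c → S'.Mor T (𝟙 A') c
  | 0, _, _, _, S, a => Extension.exists_pushout S a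
  | m + 1, _, _, _, S, a => by
    obtain ⟨R, h₁, h₂⟩ := exists_pushout S.2.1 a
    refine ⟨⟨S.1, R, S.2.2⟩, ⟨𝟙 _, h₁, Extension.Mor.id _⟩, ?_⟩
    rintro X' T c ⟨z, h, h'⟩
    exact ⟨z, h₂ _ _ h, h'⟩

lemma exists_pullback : ∀ {m : ℕ} {X A X' : C} (S : ExtSeq E m X A) (c : X' ⟶ X),
    ∃ S' : ExtSeq E m X' A, S'.Mor S (𝟙 A) c ∧
      ∀ {A' : C} (T : ExtSeq E m X' A') (a : A' ⟶ A), T.Mor S a c → T.Mor S' a (𝟙 X')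
  | 0, _, _, _, S, c => Extension.exists_pullback S c
  | m + 1, _, _, _, S, c => by
    obtain ⟨R, h₁, h₂⟩ := Extension.exists_pullback S.2.2 c
    refine ⟨⟨S.1, S.2.1, R⟩, ⟨𝟙 _, Mor.id _, h₁⟩, ?_⟩
    rintro A' T a ⟨z, h, h'⟩
    exact ⟨z, h, h₂ _ _ h'⟩

/-- The pushout `aS` of an exact sequence along a morphism `a` out of its left end. -/
noncomputable def push {m : ℕ} {X A A' : C} (a : A ⟶ A') (S : ExtSeq E m X A) :
    ExtSeq E m X A' := (S.exists_pushout a).choose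

/-- The pullback `Sc` of an exact sequence along a morphism `c` into its right end. -/
noncomputable def pull {m : ℕ} {X A X' : C} (c : X' ⟶ X) (S : ExtSeq E m X A) :
    ExtSeq E m X' A := (S.exists_pullback c).choose

lemma mor_push {m : ℕ} {X A A' : C} (a : A ⟶ A') (S : ExtSeq E m X A) :
    S.Mor (S.push a) a (𝟙 X) := (S.exists_pushout a).choose_spec.1

lemma pull_mor {m : ℕ} {X A X' : C} (c : X' ⟶ X) (S : ExtSeq E m X A) :
    (S.pull c).Mor S (𝟙 A) c := (S.exists_pullback c).choose_spec.1

lemma Mor.push_mor {m : ℕ} {X A X' A' : C} {S : ExtSeq E m X A} {T : ExtSeq E m X' A'}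
    {a : A ⟶ A'} {c : X ⟶ X'} (h : S.Mor T a c) : (S.push a).Mor T (𝟙 A') c :=
  (S.exists_pushout a).choose_spec.2 T c h

lemma Mor.mor_pull {m : ℕ} {X A X' A' : C} {S : ExtSeq E m X A} {T : ExtSeq E m X' A'}
    {a : A ⟶ A'} {c : X ⟶ X'} (h : S.Mor T a c) : S.Mor (T.pull c) a (𝟙 X) :=
  (T.exists_pullback c).choose_spec.2 S a h

lemma cls_eq {m : ℕ} {X A : C} {S T : ExtSeq E m X A} (h : S.Mor T (𝟙 A) (𝟙 X)) :
    S.cls = T.cls := Quot.sound h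

end ExtSeq

namespace ExtSucc

open ExtSeq

variable {m : ℕ}

/-- `Ext^{m+1}(X, a)`, the map `ξ ↦ aξ` induced by pushout. -/
noncomputable def push {X A A' : C} (a : A ⟶ A') : ExtSucc E m X A → ExtSucc E m X A' :=
  Quot.map (ExtSeq.push a) fun S T h =>
    Mor.push_mor (by simpa using h.comp (T.mor_push a))

/-- `Ext^{m+1}(c, A)`, the map `ξ ↦ ξc` induced by pullback. -/
noncomputable def pull {X A X' : C} (c : X' ⟶ X) : ExtSucc E m X A → ExtSucc E m X' A :=
  Quot.map (ExtSeq.pull c) fun S T h =>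
    Mor.mor_pull (by simpa using (S.pull_mor c).comp h)

lemma push_cls {X A A' : C} (a : A ⟶ A') (S : ExtSeq E m X A) :
    push a S.cls = (S.push a).cls := rfl

lemma pull_cls {X A X' : C} (c : X' ⟶ X) (S : ExtSeq E m X A) :
    pull c S.cls = (S.pull c).cls := rfl

lemma ind {X A : C} {P : ExtSucc E m X A → Prop} (h : ∀ S : ExtSeq E m X A, P S.cls) (ξ) : P ξ :=
  Quot.ind h ξ

lemma push_eq_pull {X A X' A' : C} {S : ExtSeq E m X A} {T : ExtSeq E m X' A'}
    {a : A ⟶ A'} {c : X ⟶ X'} (h : S.Mor T a c) : push a S.cls = pull c T.cls :=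
  cls_eq h.push_mor.mor_pull

lemma pull_id {X A : C} (ξ : ExtSucc E m X A) : pull (𝟙 X) ξ = ξ := by
  induction ξ using ind with
  | h S => exact cls_eq (S.pull_mor _)

lemma push_id {X A : C} (ξ : ExtSucc E m X A) : push (𝟙 A) ξ = ξ := by
  induction ξ using ind with
  | h S => exact (cls_eq (S.mor_push _)).symm

lemma push_comp {X A A' A'' : C} (a : A ⟶ A') (a' : A' ⟶ A'') (ξ : ExtSucc E m X A) :
    push (a ≫ a') ξ = push a' (push a ξ) := by
  induction ξ using ind with
  | h S =>
    have h := (S.mor_push a).comp ((S.push a).mor_push a')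
    rw [Category.comp_id] at h
    rw [push_eq_pull h, pull_id]
    rfl

lemma pull_comp {X A X' X'' : C} (c : X' ⟶ X) (c' : X'' ⟶ X') (ξ : ExtSucc E m X A) :
    pull (c' ≫ c) ξ = pull c' (pull c ξ) := by
  induction ξ using ind with
  | h S =>
    have h := ((S.pull c).pull_mor c').comp (S.pull_mor c)
    rw [Category.comp_id] at h
    rw [← push_eq_pull h, push_id]
    rfl

lemma push_pull {X A X' A' : C} (a : A ⟶ A') (c : X' ⟶ X) (ξ : ExtSucc E m X A) :
    push a (pull c ξ) = pull c (push a ξ) := by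
  induction ξ using ind with
  | h S =>
    have h := (S.pull_mor c).comp (S.mor_push a)
    rw [Category.comp_id, Category.id_comp] at h
    exact push_eq_pull h

end ExtSucc

/-! ### The Baer sum -/

section Baer

variable [HasBinaryBiproducts C] [HasZeroObject C]

/-- The direct sum of two short exact sequences. -/
noncomputable def Extension.sum {X A X' A' : C} (S : Extension E X A) (T : Extension E X' A') :
    Extension E (X ⊞ X') (A ⊞ A') where
  B := S.B ⊞ T.B
  i := biprod.map S.i T.i
  p := biprod.map S.p T.p
  w := by ext <;> simp [S.w, T.w]
  conf := E.conf_biprod S.conf T.conf _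

/-- The split short exact sequence. -/
noncomputable def Extension.split (E : ExactStructure C) (X A : C) : Extension E X A where
  B := A ⊞ X
  i := biprod.inl
  p := biprod.snd
  w := by simp
  conf := E.conf_split X A

/-- The direct sum of two exact sequences. -/
noncomputable def ExtSeq.sum : ∀ {m : ℕ} {X A X' A' : C}, ExtSeq E m X A → ExtSeq E m X' A' →
    ExtSeq E m (X ⊞ X') (A ⊞ A')
  | 0, _, _, _, _, S, T => Extension.sum S T
  | _ + 1, _, _, _, _, S, T => ⟨S.1 ⊞ T.1, ExtSeq.sum S.2.1 T.2.1, S.2.2.sum T.2.2⟩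

/-- The trivial exact sequence: the splice of the split short exact sequences
`A ⟶ A ⟶ 0`, `0 ⟶ 0 ⟶ 0`, …, `0 ⟶ X ⟶ X` (up to isomorphism). -/
noncomputable def ExtSeq.split (E : ExactStructure C) : ∀ (m : ℕ) (X A : C), ExtSeq E m X A
  | 0, X, A => Extension.split E X A
  | m + 1, X, A => ⟨0, ExtSeq.split E m 0 A, Extension.split E X 0⟩

lemma Extension.Mor.sum {X A X' A' Y B Y' B' : C} {S : Extension E X A} {T : Extension E X' A'}
    {S' : Extension E Y B} {T' : Extension E Y' B'} {a : A ⟶ B} {c : X ⟶ Y} {a' : A' ⟶ B'}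
    {c' : X' ⟶ Y'} (h : S.Mor S' a c) (h' : T.Mor T' a' c') :
    (S.sum T).Mor (S'.sum T') (biprod.map a a') (biprod.map c c') := by
  obtain ⟨b, h₁, h₂⟩ := h
  obtain ⟨b', h₁', h₂'⟩ := h'
  refine ⟨biprod.map b b', ?_, ?_⟩ <;> dsimp [Extension.sum] <;>
    ext <;> simp [reassoc_of% h₁, reassoc_of% h₂, reassoc_of% h₁', reassoc_of% h₂']

lemma ExtSeq.Mor.sum : ∀ {m : ℕ} {X A X' A' Y B Y' B' : C} {S : ExtSeq E m X A}
    {T : ExtSeq E m X' A'} {S' : ExtSeq E m Y B} {T' : ExtSeq E m Y' B'} {a : A ⟶ B} {c : X ⟶ Y}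
    {a' : A' ⟶ B'} {c' : X' ⟶ Y'}, S.Mor S' a c → T.Mor T' a' c' →
    (S.sum T).Mor (S'.sum T') (biprod.map a a') (biprod.map c c')
  | 0, _, _, _, _, _, _, _, _, _, _, _, _, _, _, _, _, h, h' => Extension.Mor.sum h h'
  | _ + 1, _, _, _, _, _, _, _, _, _, _, _, _, _, _, _, _, ⟨_, h₁, h₂⟩, ⟨_, h₁', h₂'⟩ =>
    ⟨_, ExtSeq.Mor.sum h₁ h₁', Extension.Mor.sum h₂ h₂'⟩

lemma ExtSeq.mor_diag : ∀ {m : ℕ} {X A : C} (S : ExtSeq E m X A),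
    S.Mor (S.sum S) (biprod.lift (𝟙 A) (𝟙 A)) (biprod.lift (𝟙 X) (𝟙 X))
  | 0, _, _, S => ⟨biprod.lift (𝟙 _) (𝟙 _), by
      dsimp [ExtSeq.sum, Extension.sum]; constructor <;> ext <;> simp⟩
  | _ + 1, _, _, S => ⟨biprod.lift (𝟙 _) (𝟙 _), ExtSeq.mor_diag S.2.1,
      biprod.lift (𝟙 _) (𝟙 _), by
      dsimp [ExtSeq.sum, Extension.sum]; constructor <;> ext <;> simp⟩

lemma ExtSeq.mor_braid : ∀ {m : ℕ} {X A X' A' : C} (S : ExtSeq E m X A) (T : ExtSeq E m X' A'),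
    (S.sum T).Mor (T.sum S) (biprod.lift biprod.snd biprod.fst) (biprod.lift biprod.snd biprod.fst)
  | 0, _, _, _, _, S, T => ⟨biprod.lift biprod.snd biprod.fst, by
      dsimp [ExtSeq.sum, Extension.sum]; constructor <;> ext <;> simp⟩
  | _ + 1, _, _, _, _, S, T => ⟨biprod.lift biprod.snd biprod.fst, ExtSeq.mor_braid S.2.1 T.2.1,
      biprod.lift biprod.snd biprod.fst, by
      dsimp [ExtSeq.sum, Extension.sum]; constructor <;> ext <;> simp⟩

/-- The associativity isomorphism of direct sums. -/
noncomputable abbrev assocMap (X Y Z : C) : (X ⊞ Y) ⊞ Z ⟶ X ⊞ (Y ⊞ Z) :=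
  biprod.lift (biprod.fst ≫ biprod.fst) (biprod.lift (biprod.fst ≫ biprod.snd) biprod.snd)

lemma ExtSeq.mor_assoc : ∀ {m : ℕ} {X A X' A' X'' A'' : C} (S : ExtSeq E m X A)
    (T : ExtSeq E m X' A') (U : ExtSeq E m X'' A''),
    ((S.sum T).sum U).Mor (S.sum (T.sum U)) (assocMap _ _ _) (assocMap _ _ _)
  | 0, _, _, _, _, _, _, S, T, U => ⟨assocMap _ _ _, by
      dsimp [ExtSeq.sum, Extension.sum]; constructor <;> ext <;> simp⟩
  | _ + 1, _, _, _, _, _, _, S, T, U => ⟨assocMap _ _ _, ExtSeq.mor_assoc S.2.1 T.2.1 U.2.1,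
      assocMap _ _ _, by
      dsimp [ExtSeq.sum, Extension.sum]; constructor <;> ext <;> simp⟩

lemma Extension.mor_split {X A X' A' : C} (S : Extension E X A) (c : X ⟶ X') :
    S.Mor (Extension.split E X' A') 0 c :=
  ⟨S.p ≫ c ≫ biprod.inr, by simp [reassoc_of% S.w], by simp [Extension.split]⟩

lemma ExtSeq.mor_split : ∀ {m : ℕ} {X A X' A' : C} (S : ExtSeq E m X A) (c : X ⟶ X'),
    S.Mor (ExtSeq.split E m X' A') 0 c
  | 0, _, _, _, _, S, c => Extension.mor_split S c
  | _ + 1, _, _, _, _, S, c => ⟨0, ExtSeq.mor_split S.2.1 0, Extension.mor_split S.2.2 c⟩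

namespace ExtSucc

open ExtSeq

variable {m : ℕ}

lemma map_id_id (X Y : C) : biprod.map (𝟙 X) (𝟙 Y) = 𝟙 (X ⊞ Y) := by ext <;> simp

lemma lift_map {W X Y X' Y' : C} (a : W ⟶ X) (b : W ⟶ Y) (f : X ⟶ X') (g : Y ⟶ Y') :
    biprod.lift a b ≫ biprod.map f g = biprod.lift (a ≫ f) (b ≫ g) := by ext <;> simp

/-- Direct sum of extension classes. -/
noncomputable def sum {X A X' A' : C} : ExtSucc E m X A → ExtSucc E m X' A' →
    ExtSucc E m (X ⊞ X') (A ⊞ A') :=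
  Quot.map₂ ExtSeq.sum
    (fun S T T' h => by simpa only [map_id_id] using (Mor.id S).sum h)
    (fun S S' T h => by simpa only [map_id_id] using h.sum (Mor.id T))

lemma sum_cls {X A X' A' : C} (S : ExtSeq E m X A) (T : ExtSeq E m X' A') :
    sum S.cls T.cls = (S.sum T).cls := rfl

lemma push_sum {X A X' A' Y Y' : C} (a : A ⟶ Y) (a' : A' ⟶ Y') (ξ : ExtSucc E m X A)
    (ξ' : ExtSucc E m X' A') :
    push (biprod.map a a') (sum ξ ξ') = sum (push a ξ) (push a' ξ') := by
  induction ξ using ind with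
  | h S =>
    induction ξ' using ind with
    | h T =>
      have h := (S.mor_push a).sum (T.mor_push a')
      rw [show biprod.map (𝟙 X) (𝟙 X') = 𝟙 _ by ext <;> simp] at h
      rw [sum_cls, push_eq_pull h, pull_id]
      rfl

lemma pull_sum {X A X' A' Y Y' : C} (c : Y ⟶ X) (c' : Y' ⟶ X') (ξ : ExtSucc E m X A)
    (ξ' : ExtSucc E m X' A') :
    pull (biprod.map c c') (sum ξ ξ') = sum (pull c ξ) (pull c' ξ') := by
  induction ξ using ind with
  | h S =>
    induction ξ' using ind with
    | h T =>
      have h := (S.pull_mor c).sum (T.pull_mor c')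
      rw [show biprod.map (𝟙 A) (𝟙 A') = 𝟙 _ by ext <;> simp] at h
      rw [sum_cls, ← push_eq_pull h, push_id]
      rfl

/-- The Baer sum `ξ + ξ' = ∇(ξ ⊕ ξ')Δ`. -/
noncomputable instance (X A : C) : Add (ExtSucc E m X A) where
  add ξ ξ' := push (biprod.desc (𝟙 A) (𝟙 A)) (pull (biprod.lift (𝟙 X) (𝟙 X)) (sum ξ ξ'))

/-- The class of the trivial exact sequence. -/
noncomputable instance (X A : C) : Zero (ExtSucc E m X A) where
  zero := (ExtSeq.split E m X A).cls

noncomputable instance (X A : C) : Neg (ExtSucc E m X A) where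
  neg ξ := push (-𝟙 A) ξ

lemma add_def {X A : C} (ξ ξ' : ExtSucc E m X A) : ξ + ξ' =
    push (biprod.desc (𝟙 A) (𝟙 A)) (pull (biprod.lift (𝟙 X) (𝟙 X)) (sum ξ ξ')) := rfl

lemma push_zero {X A A' : C} (ξ : ExtSucc E m X A) : push (0 : A ⟶ A') ξ = 0 := by
  induction ξ using ind with
  | h S => rw [push_eq_pull (S.mor_split (A' := A') (𝟙 X)), pull_id]; rfl

lemma push_add {X A A' : C} (a : A ⟶ A') (ξ ξ' : ExtSucc E m X A) :
    push a (ξ + ξ') = push a ξ + push a ξ' := by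
  rw [add_def, add_def, ← push_sum, ← push_comp, ← push_pull, ← push_comp]
  congr 1
  ext <;> simp

lemma pull_add {X A X' : C} (c : X' ⟶ X) (ξ ξ' : ExtSucc E m X A) :
    pull c (ξ + ξ') = pull c ξ + pull c ξ' := by
  rw [add_def, add_def, ← pull_sum, ← pull_comp, ← push_pull, ← pull_comp]
  congr 2
  ext <;> simp

lemma add_push {X A A' : C} (a a' : A ⟶ A') (ξ : ExtSucc E m X A) :
    push (a + a') ξ = push a ξ + push a' ξ := by
  have h : pull (biprod.lift (𝟙 X) (𝟙 X)) (sum ξ ξ) = push (biprod.lift (𝟙 A) (𝟙 A)) ξ := by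
    induction ξ using ind with
    | h S => exact (push_eq_pull S.mor_diag).symm
  rw [add_def, ← push_sum, ← push_pull, h, ← push_comp, ← push_comp]
  congr 1
  rw [← Category.assoc, lift_map, biprod.lift_desc]
  simp

lemma push_neg_id_add {X A : C} (ξ : ExtSucc E m X A) : push (-𝟙 A) ξ + ξ = 0 := by
  have h := add_push (-𝟙 A) (𝟙 A) ξ
  rw [neg_add_cancel, push_zero, push_id] at h
  exact h.symm

lemma add_zero' {X A : C} (ξ : ExtSucc E m X A) : ξ + 0 = ξ := by
  have h := add_push (𝟙 A) 0 ξ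
  rw [add_zero, push_zero, push_id] at h
  exact h.symm

lemma add_comm' {X A : C} (ξ ξ' : ExtSucc E m X A) : ξ + ξ' = ξ' + ξ := by
  induction ξ using ind with
  | h S =>
    induction ξ' using ind with
    | h T =>
      have h := push_eq_pull (S.mor_braid T)
      have e : biprod.desc (𝟙 A) (𝟙 A) =
        biprod.lift biprod.snd biprod.fst ≫ biprod.desc (𝟙 A) (𝟙 A) := by ext <;> simp
      rw [add_def, sum_cls, e, push_comp, push_pull, h, ← pull_comp, add_def, sum_cls]
      congr 2
      ext <;> simp

lemma add_assoc' {X A : C} (ξ ξ' ξ'' : ExtSucc E m X A) : ξ + ξ' + ξ'' = ξ + (ξ' + ξ'') := by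
  induction ξ using ind with
  | h S =>
    induction ξ' using ind with
    | h T =>
      induction ξ'' using ind with
      | h U =>
        have h := push_eq_pull (S.mor_assoc T U)
        have e₁ : S.cls + T.cls + U.cls =
            push (biprod.map (biprod.desc (𝟙 A) (𝟙 A)) (𝟙 A) ≫ biprod.desc (𝟙 A) (𝟙 A))
              (pull (biprod.lift (𝟙 X) (𝟙 X) ≫ biprod.map (biprod.lift (𝟙 X) (𝟙 X)) (𝟙 X))
                ((S.sum T).sum U).cls) := by
          rw [add_def _ U.cls, add_def, ← push_id U.cls, ← pull_id U.cls, ← push_sum, ← pull_sum,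
            ← push_pull, ← pull_comp, ← push_comp]
          rfl
        have e₂ : S.cls + (T.cls + U.cls) =
            push (biprod.map (𝟙 A) (biprod.desc (𝟙 A) (𝟙 A)) ≫ biprod.desc (𝟙 A) (𝟙 A))
              (pull (biprod.lift (𝟙 X) (𝟙 X) ≫ biprod.map (𝟙 X) (biprod.lift (𝟙 X) (𝟙 X)))
                (S.sum (T.sum U)).cls) := by
          rw [add_def, add_def, ← push_id S.cls, ← pull_id S.cls, ← push_sum, ← pull_sum,
            ← push_pull, ← pull_comp, ← push_comp]
          rfl
        have e : biprod.map (biprod.desc (𝟙 A) (𝟙 A)) (𝟙 A) ≫ biprod.desc (𝟙 A) (𝟙 A) =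
            assocMap A A A ≫ biprod.map (𝟙 A) (biprod.desc (𝟙 A) (𝟙 A)) ≫
              biprod.desc (𝟙 A) (𝟙 A) := by
          rw [assocMap, ← Category.assoc (biprod.lift _ _), lift_map, biprod.lift_desc]
          simp only [Category.comp_id, biprod.lift_desc]
          ext <;> simp
        rw [e₁, e₂, e, push_comp, push_pull, h, ← pull_comp]
        congr 2
        ext <;> simp

/-- `Ext^{m+1}(X, A)` is an abelian group under the Baer sum. -/
noncomputable instance (X A : C) : AddCommGroup (ExtSucc E m X A) where
  add_assoc := add_assoc'
  add_comm := add_comm'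
  add_zero := add_zero'
  zero_add ξ := by rw [add_comm', add_zero']
  neg_add_cancel := push_neg_id_add
  nsmul := nsmulRec
  zsmul := zsmulRec

end ExtSucc

end Baer

end Exact

/-! ### Exact functors and the induced maps on extensions -/

section Functor

variable {C : Type u} [Category.{v} C] [Preadditive C]
  {D : Type u'} [Category.{v'} D] [Preadditive D]

/-- The functor `F` sends short exact sequences to short exact sequences. -/
def IsExactFunctor (E : ExactStructure C) (E' : ExactStructure D) (F : C ⥤ D)
    [F.PreservesZeroMorphisms] : Prop :=
  ∀ S : ShortComplex C, E.conf S → E'.conf (S.map F)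

/-- The functor `F` sends short exact sequences with all three terms in the class `P` to short
exact sequences. -/
def IsExactOn (E : ExactStructure C) (E' : ExactStructure D) (F : C ⥤ D)
    [F.PreservesZeroMorphisms] (P : ObjectProperty C) : Prop :=
  ∀ S : ShortComplex C, E.conf S → P S.X₁ → P S.X₂ → P S.X₃ → E'.conf (S.map F)

variable {E : ExactStructure C} {E' : ExactStructure D} {F : C ⥤ D}

/-- The image of a short exact sequence under an exact functor. -/
def Extension.map [F.PreservesZeroMorphisms] (hF : IsExactFunctor E E' F) {X A : C}
    (S : Extension E X A) : Extension E' (F.obj X) (F.obj A) where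
  B := F.obj S.B
  i := F.map S.i
  p := F.map S.p
  w := by rw [← F.map_comp, S.w, F.map_zero]
  conf := hF _ S.conf

/-- The image of an exact sequence under an exact functor. -/
def ExtSeq.map [F.PreservesZeroMorphisms] (hF : IsExactFunctor E E' F) :
    ∀ {m : ℕ} {X A : C}, ExtSeq E m X A → ExtSeq E' m (F.obj X) (F.obj A)
  | 0, _, _, S => Extension.map hF S
  | _ + 1, _, _, S => ⟨F.obj S.1, ExtSeq.map hF S.2.1, S.2.2.map hF⟩

lemma Extension.Mor.map [F.PreservesZeroMorphisms] (hF : IsExactFunctor E E' F)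
    {X A X' A' : C} {S : Extension E X A} {T : Extension E X' A'} {a : A ⟶ A'} {c : X ⟶ X'}
    (h : S.Mor T a c) : (S.map hF).Mor (T.map hF) (F.map a) (F.map c) := by
  obtain ⟨b, h₁, h₂⟩ := h
  exact ⟨F.map b, by simpa only [Extension.map, F.map_comp] using congrArg F.map h₁,
    by simpa only [Extension.map, F.map_comp] using congrArg F.map h₂⟩

lemma ExtSeq.Mor.map [F.PreservesZeroMorphisms] (hF : IsExactFunctor E E' F) :
    ∀ {m : ℕ} {X A X' A' : C} {S : ExtSeq E m X A} {T : ExtSeq E m X' A'} {a : A ⟶ A'}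
      {c : X ⟶ X'}, S.Mor T a c → (S.map hF).Mor (T.map hF) (F.map a) (F.map c)
  | 0, _, _, _, _, _, _, _, _, h => Extension.Mor.map hF h
  | _ + 1, _, _, _, _, _, _, _, _, ⟨_, h₁, h₂⟩ =>
    ⟨_, ExtSeq.Mor.map hF h₁, Extension.Mor.map hF h₂⟩

namespace ExtSucc

variable {m : ℕ}

/-- The map `ξ ↦ F(ξ)` on extension classes induced by an exact functor `F`. -/
def map [F.PreservesZeroMorphisms] (hF : IsExactFunctor E E' F) {X A : C} :
    ExtSucc E m X A → ExtSucc E' m (F.obj X) (F.obj A) :=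
  Quot.map (ExtSeq.map hF) fun S T h => by
    simpa only [F.map_id] using ExtSeq.Mor.map hF h

lemma map_push [F.PreservesZeroMorphisms] (hF : IsExactFunctor E E' F) {X A A' : C}
    (a : A ⟶ A') (ξ : ExtSucc E m X A) : map hF (push a ξ) = push (F.map a) (map hF ξ) := by
  induction ξ using ind with
  | h S =>
    have h := push_eq_pull (ExtSeq.Mor.map hF (S.mor_push a))
    rw [F.map_id, pull_id] at h
    exact h.symm

lemma map_pull [F.PreservesZeroMorphisms] (hF : IsExactFunctor E E' F) {X X' A : C}
    (c : X' ⟶ X) (ξ : ExtSucc E m X A) : map hF (pull c ξ) = pull (F.map c) (map hF ξ) := by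
  induction ξ using ind with
  | h S =>
    have h := push_eq_pull (ExtSeq.Mor.map hF (S.pull_mor c))
    rw [F.map_id, push_id] at h
    exact h

variable [HasBinaryBiproducts C] [HasZeroObject C] [HasBinaryBiproducts D] [HasZeroObject D]

/-- The comparison `F(X ⊞ Y) ⟶ F(X) ⊞ F(Y)`. -/
noncomputable abbrev comparison (F : C ⥤ D) (X Y : C) : F.obj (X ⊞ Y) ⟶ F.obj X ⊞ F.obj Y :=
  biprod.lift (F.map biprod.fst) (F.map biprod.snd)

lemma mor_comparison [F.PreservesZeroMorphisms] (hF : IsExactFunctor E E' F) :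
    ∀ {m : ℕ} {X A X' A' : C} (S : ExtSeq E m X A) (T : ExtSeq E m X' A'),
      ((S.sum T).map hF).Mor ((S.map hF).sum (T.map hF)) (comparison F A A') (comparison F X X')
  | 0, _, _, _, _, S, T => ⟨comparison F _ _, by
      dsimp [ExtSeq.sum, ExtSeq.map, Extension.sum, Extension.map]
      constructor <;> ext <;> simp only [Category.assoc, biprod.lift_fst, biprod.lift_snd,
        biprod.map_fst, biprod.map_snd, biprod.lift_fst_assoc, biprod.lift_snd_assoc, ← F.map_comp]⟩
  | _ + 1, _, _, _, _, S, T => ⟨comparison F _ _, mor_comparison hF S.2.1 T.2.1,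
      comparison F _ _, by
      dsimp [ExtSeq.sum, ExtSeq.map, Extension.sum, Extension.map]
      constructor <;> ext <;> simp only [Category.assoc, biprod.lift_fst, biprod.lift_snd,
        biprod.map_fst, biprod.map_snd, biprod.lift_fst_assoc, biprod.lift_snd_assoc, ← F.map_comp]⟩

lemma map_add [F.Additive] (hF : IsExactFunctor E E' F) {X A : C} (ξ ξ' : ExtSucc E m X A) :
    map hF (ξ + ξ') = map hF ξ + map hF ξ' := by
  induction ξ using ind with
  | h S =>
    induction ξ' using ind with
    | h T =>
      have h := push_eq_pull (mor_comparison hF S T)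
      have e : F.map (biprod.desc (𝟙 A) (𝟙 A)) =
          comparison F A A ≫ biprod.desc (𝟙 (F.obj A)) (𝟙 (F.obj A)) := by
        rw [biprod.lift_desc, Category.comp_id, Category.comp_id, ← F.map_add]
        congr 1
        ext <;> simp
      have e' : F.map (biprod.lift (𝟙 X) (𝟙 X)) ≫ comparison F X X =
          biprod.lift (𝟙 (F.obj X)) (𝟙 (F.obj X)) := by
        ext <;> simp [← F.map_comp]
      rw [add_def, map_push, map_pull, e, push_comp, push_pull]
      refine (congrArg _ (congrArg _ h)).trans ?_
      rw [← pull_comp, e']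
      rfl

end ExtSucc

/-- Both functors of an adjoint pair between additive categories are automatically additive. -/
lemma additive_of_adjunction [HasBinaryBiproducts C] [HasZeroObject C] [HasBinaryBiproducts D]
    [HasZeroObject D] {q : C ⥤ D} {t : D ⥤ C} (adj : q ⊣ t) : q.Additive ∧ t.Additive := by
  have := adj.rightAdjoint_preservesLimits
  have ht : t.Additive := t.additive_of_preserves_binary_products
  exact ⟨adj.left_adjoint_additive, ht⟩

/-! ### The natural transformations `Θ` and `Ω` of an adjoint pair -/

variable [HasBinaryBiproducts C] [HasZeroObject C] [HasBinaryBiproducts D] [HasZeroObject D]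
  {q : C ⥤ D} {t : D ⥤ C}

/-- `Θ^{m+1}_{XY} : Ext^{m+1}(q(X), Y) ⟶ Ext^{m+1}(X, t(Y))`, for a left adjoint `q` of an exact
functor `t`: apply `t` and pull back along the unit `X ⟶ tq(X)`. -/
noncomputable def thetaSucc [t.Additive] (adj : q ⊣ t) (ht : IsExactFunctor E' E t) (m : ℕ)
    (X : C) (Y : D) : ExtSucc E' m (q.obj X) Y →+ ExtSucc E m X (t.obj Y) :=
  AddMonoidHom.mk' (fun ξ => ExtSucc.pull (adj.unit.app X) (ExtSucc.map ht ξ))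
    fun ξ ξ' => by rw [ExtSucc.map_add]; exact ExtSucc.pull_add _ _ _

/-- `Ω^{m+1}_{XY} : Ext^{m+1}(X, t(Y)) ⟶ Ext^{m+1}(q(X), Y)`, for a right adjoint `t` of an exact
functor `q`: apply `q` and push out along the counit `qt(Y) ⟶ Y`. -/
noncomputable def omegaSucc [q.Additive] (adj : q ⊣ t) (hq : IsExactFunctor E E' q) (m : ℕ)
    (X : C) (Y : D) : ExtSucc E m X (t.obj Y) →+ ExtSucc E' m (q.obj X) Y :=
  AddMonoidHom.mk' (fun ξ => ExtSucc.push (adj.counit.app Y) (ExtSucc.map hq ξ))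
    fun ξ ξ' => by rw [ExtSucc.map_add]; exact ExtSucc.push_add _ _ _

/-- `Θ^{m+1}_X` is natural in the second variable. -/
lemma thetaSucc_naturality [t.Additive] (adj : q ⊣ t) (ht : IsExactFunctor E' E t) (m : ℕ)
    (X : C) {Y Y' : D} (f : Y ⟶ Y') (ξ : ExtSucc E' m (q.obj X) Y) :
    thetaSucc adj ht m X Y' (ExtSucc.push f ξ) =
      ExtSucc.push (t.map f) (thetaSucc adj ht m X Y ξ) := by
  simp only [thetaSucc, AddMonoidHom.mk'_apply, ExtSucc.map_push, ExtSucc.push_pull]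

/-- `Ω^{m+1}_Y` is natural in the first variable. -/
lemma omegaSucc_naturality [q.Additive] (adj : q ⊣ t) (hq : IsExactFunctor E E' q) (m : ℕ)
    {X X' : C} (f : X' ⟶ X) (Y : D) (ξ : ExtSucc E m X (t.obj Y)) :
    omegaSucc adj hq m X' Y (ExtSucc.pull f ξ) =
      ExtSucc.pull (q.map f) (omegaSucc adj hq m X Y ξ) := by
  simp only [omegaSucc, AddMonoidHom.mk'_apply, ExtSucc.map_pull, ExtSucc.push_pull]

end Functor

/-! ### The exact structure of an abelian category -/

lemma isAdmissibleMono_shortExact_iff {D : Type u'} [Category.{v'} D] [Abelian D] {X Y : D}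
    (i : X ⟶ Y) : IsAdmissibleMono (fun S : ShortComplex D => S.ShortExact) i ↔ Mono i :=
  ⟨fun ⟨_, _, _, h⟩ => h.mono_f, fun _ => ⟨cokernel i, cokernel.π i, cokernel.condition i,
    { exact := ShortComplex.exact_cokernel i }⟩⟩

lemma isAdmissibleEpi_shortExact_iff {D : Type u'} [Category.{v'} D] [Abelian D] {X Y : D}
    (p : X ⟶ Y) : IsAdmissibleEpi (fun S : ShortComplex D => S.ShortExact) p ↔ Epi p :=
  ⟨fun ⟨_, _, _, h⟩ => h.epi_g, fun _ => ⟨kernel p, kernel.ι p, kernel.condition p,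
    { exact := ShortComplex.exact_kernel p }⟩⟩

/-- An abelian category with its standard exact structure, consisting of all short exact
sequences. -/
def abelianStructure (D : Type u') [Category.{v'} D] [Abelian D] : ExactStructure D :=
  { conf := fun S => S.ShortExact
    conf_of_iso := fun e h => ShortComplex.shortExact_of_iso e h
    isKernel := fun S h => ⟨h.fIsKernel⟩
    isCokernel := fun S h => ⟨h.gIsCokernel⟩
    mono_id := fun X => (isAdmissibleMono_shortExact_iff _).2 inferInstance
    epi_id := fun X => (isAdmissibleEpi_shortExact_iff _).2 inferInstance
    mono_comp := fun i j hi hj => by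
      have := (isAdmissibleMono_shortExact_iff _).1 hi
      have := (isAdmissibleMono_shortExact_iff _).1 hj
      exact (isAdmissibleMono_shortExact_iff _).2 (mono_comp i j)
    epi_comp := fun p q hp hq => by
      have := (isAdmissibleEpi_shortExact_iff _).1 hp
      have := (isAdmissibleEpi_shortExact_iff _).1 hq
      exact (isAdmissibleEpi_shortExact_iff _).2 (epi_comp p q)
    pushout := fun i f hi => by
      have := (isAdmissibleMono_shortExact_iff _).1 hi
      exact ⟨_, _, _, IsPushout.of_hasPushout i f, (isAdmissibleMono_shortExact_iff _).2 inferInstance⟩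
    pullback := fun p f hp => by
      have := (isAdmissibleEpi_shortExact_iff _).1 hp
      exact ⟨_, _, _, IsPullback.of_hasPullback p f, (isAdmissibleEpi_shortExact_iff _).2 inferInstance⟩ }

/-! ### Resolutions and relative derived functors -/

section Derived

variable {C : Type u} [Category.{v} C] [Preadditive C]

/-- `F` is extension closed, generating and closed under kernels of admissible epics. -/
structure IsResolving (E : ExactStructure C) (F : ObjectProperty C) : Prop where
  extension : ∀ S : ShortComplex C, E.conf S → F S.X₁ → F S.X₃ → F S.X₂
  generating : ∀ X : C, ∃ (P : C) (p : P ⟶ X), F P ∧ IsAdmissibleEpi E.conf p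
  kernel : ∀ S : ShortComplex C, E.conf S → F S.X₂ → F S.X₃ → F S.X₁

/-- `G` is extension closed, cogenerating and closed under cokernels of admissible monics. -/
structure IsCoresolving (E : ExactStructure C) (G : ObjectProperty C) : Prop where
  extension : ∀ S : ShortComplex C, E.conf S → G S.X₁ → G S.X₃ → G S.X₂
  cogenerating : ∀ X : C, ∃ (I : C) (i : X ⟶ I), G I ∧ IsAdmissibleMono E.conf i
  cokernel : ∀ S : ShortComplex C, E.conf S → G S.X₁ → G S.X₂ → G S.X₃

/-- An `F`-resolution of `X`: an exact sequence `⋯ ⟶ F₁ ⟶ F₀ ⟶ X` with all `Fₙ` in `F`,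
recorded by the deleted complex `⋯ ⟶ F₁ ⟶ F₀ ⟶ 0` together with the short exact sequences
`Z (n + 1) ⟶ F n ⟶ Z n` (with `Z 0 ≅ X`) into which it decomposes. -/
structure Resolution (E : ExactStructure C) (F : ObjectProperty C) (X : C) where
  complex : ChainComplex C ℕ
  mem : ∀ n, F (complex.X n)
  Z : ℕ → C
  i : ∀ n, Z (n + 1) ⟶ complex.X n
  p : ∀ n, complex.X n ⟶ Z n
  w : ∀ n, i n ≫ p n = 0
  conf : ∀ n, E.conf (ShortComplex.mk (i n) (p n) (w n))
  d_eq : ∀ n, complex.d (n + 1) n = p (n + 1) ≫ i n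
  iso : Z 0 ≅ X

/-- A `G`-coresolution of `X`: an exact sequence `X ⟶ G⁰ ⟶ G¹ ⟶ ⋯` with all `Gⁿ` in `G`,
recorded by the deleted complex `0 ⟶ G⁰ ⟶ G¹ ⟶ ⋯` together with the short exact sequences
`Z n ⟶ G n ⟶ Z (n + 1)` (with `Z 0 ≅ X`) into which it decomposes. -/
structure Coresolution (E : ExactStructure C) (G : ObjectProperty C) (X : C) where
  complex : CochainComplex C ℕ
  mem : ∀ n, G (complex.X n)
  Z : ℕ → C
  i : ∀ n, Z n ⟶ complex.X n
  p : ∀ n, complex.X n ⟶ Z (n + 1)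
  w : ∀ n, i n ≫ p n = 0
  conf : ∀ n, E.conf (ShortComplex.mk (i n) (p n) (w n))
  d_eq : ∀ n, complex.d n (n + 1) = p n ≫ i (n + 1)
  iso : Z 0 ≅ X

/-- Resolutions by a resolving class exist. -/
lemma IsResolving.nonempty_resolution {E : ExactStructure C} {F : ObjectProperty C}
    (hF : IsResolving E F) (X : C) : Nonempty (Resolution E F X) := by
  choose P p hP K i w h using hF.generating
  let Z : ℕ → C := fun n => Nat.rec X (fun _ Z => K Z) n
  exact ⟨{
    complex := ChainComplex.of (fun n => P (Z n)) (fun n => p (Z (n + 1)) ≫ i (Z n))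
      (fun n => by
        change (p (Z (n + 1 + 1)) ≫ i (Z (n + 1))) ≫ p (Z (n + 1)) ≫ i (Z n) = 0
        rw [Category.assoc, reassoc_of% (w (Z (n + 1))), zero_comp, comp_zero])
    mem := fun n => hP _
    Z := Z
    i := fun n => i (Z n)
    p := fun n => p (Z n)
    w := fun n => w (Z n)
    conf := fun n => h (Z n)
    d_eq := fun n => ChainComplex.of_d (fun n => P (Z n)) (fun n => p (Z (n + 1)) ≫ i (Z n)) n
    iso := Iso.refl X }⟩

/-- Coresolutions by a coresolving class exist. -/
lemma IsCoresolving.nonempty_coresolution {E : ExactStructure C} {G : ObjectProperty C}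
    (hG : IsCoresolving E G) (X : C) : Nonempty (Coresolution E G X) := by
  choose I i hI K p w h using hG.cogenerating
  let Z : ℕ → C := fun n => Nat.rec X (fun _ Z => K Z) n
  exact ⟨{
    complex := CochainComplex.of (fun n => I (Z n)) (fun n => p (Z n) ≫ i (Z (n + 1)))
      (fun n => by
        change (p (Z n) ≫ i (Z (n + 1))) ≫ p (Z (n + 1)) ≫ i (Z (n + 1 + 1)) = 0
        rw [Category.assoc, reassoc_of% (w (Z (n + 1))), zero_comp, comp_zero])
    mem := fun n => hI _
    Z := Z
    i := fun n => i (Z n)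
    p := fun n => p (Z n)
    w := fun n => w (Z n)
    conf := fun n => h (Z n)
    d_eq := fun n => CochainComplex.of_d (fun n => I (Z n)) (fun n => p (Z n) ≫ i (Z (n + 1))) n
    iso := Iso.refl X }⟩

/-- `L_k^F q(X) = H_k(q(F_*))`, computed by the `F`-resolution `P = F_*` of `X`. -/
noncomputable def leftDerived {D : Type u'} [Category.{v'} D] [Abelian D] (q : C ⥤ D)
    [q.PreservesZeroMorphisms] {E : ExactStructure C} {F : ObjectProperty C} {X : C}
    (P : Resolution E F X) (k : ℕ) : D :=
  ((q.mapHomologicalComplex _).obj P.complex).homology k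

/-- `R^k_G t(X) = H^k(t(G^*))`, computed by the `G`-coresolution `I = G^*` of `X`. -/
noncomputable def rightDerived {D : Type u'} [Category.{v'} D] [Abelian D] (t : C ⥤ D)
    [t.PreservesZeroMorphisms] {E : ExactStructure C} {G : ObjectProperty C} {X : C}
    (I : Coresolution E G X) (k : ℕ) : D :=
  ((t.mapHomologicalComplex _).obj I.complex).homology k

end Derived

end ExactCat

namespace ExactCat

section LongExactSequence

variable {C : Type u} [Category.{v} C] [Preadditive C] {E : ExactStructure C}

namespace ExactStructure

/-- If `N ⟶ B ⟶ Y` and `Z ⟶ Y ⟶ X` are short exact, then the preimage of `Z` in `B` is an extension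
of `Z` by `N` and the kernel of `B ⟶ X`. -/
lemma exists_preimage {X Y Z N : C} (T : Extension E Y N) {i : Z ⟶ Y} {p : Y ⟶ X} {w : i ≫ p = 0}
    (h : E.conf (ShortComplex.mk i p w)) :
    ∃ (U : Extension E Z N) (g : U.B ⟶ T.B) (hg : g ≫ T.p ≫ p = 0),
      E.conf (ShortComplex.mk g (T.p ≫ p) hg) ∧ U.i ≫ g = T.i ∧ g ≫ T.p = U.p ≫ i := by
  obtain ⟨B, g, p', sq, hp'⟩ := E.pullback T.p i ⟨_, _, _, T.conf⟩
  obtain ⟨i', w', hg, h'⟩ := E.conf_pullback T.conf sq hp'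
  have := E.mono_of_conf h
  have : Mono g := ⟨fun a b e => sq.hom_ext e (by
    rw [← cancel_mono i, Category.assoc, Category.assoc, ← sq.w, reassoc_of% e])⟩
  have w₂ : g ≫ T.p ≫ p = 0 := by rw [sq.w_assoc, w, comp_zero]
  refine ⟨⟨B, i', p', w', h'⟩, g, w₂, E.conf_of_isKernel
    (E.epi_comp _ _ ⟨_, _, _, T.conf⟩ ⟨_, _, _, h⟩) w₂ fun k hk => ?_, hg, sq.w⟩
  obtain ⟨l, hl⟩ := E.exists_lift h (k ≫ T.p) (by simpa using hk)
  exact ⟨sq.lift k l hl.symm, by simp⟩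

end ExactStructure

namespace Extension

lemma exists_retraction_iff_exists_section {X A : C} (S : Extension E X A) :
    (∃ r : S.B ⟶ A, S.i ≫ r = 𝟙 A) ↔ ∃ s : X ⟶ S.B, s ≫ S.p = 𝟙 X := by
  have := E.epi_of_conf S.conf
  have := E.mono_of_conf S.conf
  constructor
  · rintro ⟨r, hr⟩
    obtain ⟨s, hs⟩ := E.exists_desc S.conf (𝟙 S.B - r ≫ S.i) (by simp [reassoc_of% hr])
    exact ⟨s, by simp [← cancel_epi S.p, reassoc_of% hs, S.w]⟩
  · rintro ⟨s, hs⟩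
    obtain ⟨r, hr⟩ := E.exists_lift S.conf (𝟙 S.B - S.p ≫ s) (by simp [hs])
    exact ⟨r, by simp [← cancel_mono S.i, hr, reassoc_of% S.w]⟩

lemma Mor.exists_section_iff {X A : C} {S T : Extension E X A} (h : S.Mor T (𝟙 A) (𝟙 X)) :
    (∃ s : X ⟶ S.B, s ≫ S.p = 𝟙 X) ↔ ∃ s : X ⟶ T.B, s ≫ T.p = 𝟙 X := by
  obtain ⟨b, h₁, h₂⟩ := h
  constructor
  · rintro ⟨s, hs⟩
    exact ⟨s ≫ b, by rw [Category.assoc, ← h₂, Category.comp_id, hs]⟩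
  · rw [← exists_retraction_iff_exists_section, ← exists_retraction_iff_exists_section]
    rintro ⟨r, hr⟩
    exact ⟨b ≫ r, by rw [reassoc_of% h₁, hr]⟩

lemma exists_section_iff_of_cls_eq {X A : C} {S T : Extension E X A}
    (h : ExtSeq.cls (E := E) (m := 0) S = ExtSeq.cls (E := E) (m := 0) T) :
    (∃ s : X ⟶ S.B, s ≫ S.p = 𝟙 X) ↔ ∃ s : X ⟶ T.B, s ≫ T.p = 𝟙 X :=
  iff_of_eq (congrArg (Quot.lift (fun S : ExtSeq E 0 X A => ∃ s : X ⟶ Extension.B S,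
    s ≫ Extension.p S = 𝟙 X) fun _ _ h => propext (Mor.exists_section_iff h)) h)

variable [HasBinaryBiproducts C] [HasZeroObject C]

lemma cls_eq_zero_iff_exists_section {X A : C} (S : Extension E X A) :
    ExtSeq.cls (E := E) (m := 0) S = 0 ↔ ∃ s : X ⟶ S.B, s ≫ S.p = 𝟙 X := by
  constructor
  · intro h
    exact (exists_section_iff_of_cls_eq (T := Extension.split E X A) h).2
      ⟨biprod.inr, by simp [Extension.split]⟩
  · rintro ⟨s, hs⟩
    exact (ExtSeq.cls_eq (S := ExtSeq.split E 0 X A) (T := S)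
      ⟨biprod.desc S.i s, by simp [ExtSeq.split, Extension.split], by
        apply biprod.hom_ext' <;> simp [ExtSeq.split, Extension.split, S.w, hs]⟩).symm

lemma cls_eq_zero_iff_exists_retraction {X A : C} (S : Extension E X A) :
    ExtSeq.cls (E := E) (m := 0) S = 0 ↔ ∃ r : S.B ⟶ A, S.i ≫ r = 𝟙 A := by
  rw [cls_eq_zero_iff_exists_section, exists_retraction_iff_exists_section]

/-- The morphism from an extension `Z ⟶ B ⟶ X` to `B ⟶ B ⟶ 0`. -/
lemma mor_split_zero {X Z : C} (S : Extension E X Z) :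
    S.Mor (Extension.split E 0 S.B) S.i 0 :=
  ⟨biprod.inl, by simp [Extension.split], by simp [Extension.split]⟩

/-- The morphism from `0 ⟶ B ⟶ B` to an extension `Z ⟶ B ⟶ X`. -/
lemma split_zero_mor {X Z : C} (S : Extension E X Z) :
    (Extension.split E S.B 0).Mor S 0 S.p :=
  ⟨biprod.snd, by simp [Extension.split], by simp [Extension.split]⟩

end Extension

section

variable [HasBinaryBiproducts C] [HasZeroObject C]

lemma ExtSeq.mor_codiag : ∀ {m : ℕ} {X A : C} (S : ExtSeq E m X A),
    (S.sum S).Mor S (biprod.desc (𝟙 A) (𝟙 A)) (biprod.desc (𝟙 X) (𝟙 X))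
  | 0, _, _, S => ⟨biprod.desc (𝟙 _) (𝟙 _), by
      dsimp [ExtSeq.sum, Extension.sum]; constructor <;> ext <;> simp⟩
  | _ + 1, _, _, S => ⟨biprod.desc (𝟙 _) (𝟙 _), ExtSeq.mor_codiag S.2.1,
      biprod.desc (𝟙 _) (𝟙 _), by
      dsimp [ExtSeq.sum, Extension.sum]; constructor <;> ext <;> simp⟩

lemma ExtSeq.split_mor : ∀ {m : ℕ} {X A X' : C} (S : ExtSeq E m X' A),
    (ExtSeq.split E m X A).Mor S (𝟙 A) 0
  | 0, _, _, _, S => ⟨biprod.desc (Extension.i S) 0, by simp [ExtSeq.split, Extension.split], by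
      apply biprod.hom_ext' <;> simp [ExtSeq.split, Extension.split, Extension.w S]⟩
  | _ + 1, _, _, _, S => ⟨0, ExtSeq.split_mor S.2.1, 0, by simp, by simp⟩

namespace ExtSucc

variable {m : ℕ}

lemma pull_zero {X A X' : C} (ξ : ExtSucc E m X A) : pull (0 : X' ⟶ X) ξ = 0 := by
  induction ξ using ind with
  | h S => rw [← push_eq_pull (S.split_mor (X := X')), push_id]; rfl

lemma add_pull {X A X' : C} (c c' : X' ⟶ X) (ξ : ExtSucc E m X A) :
    pull (c + c') ξ = pull c ξ + pull c' ξ := by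
  have h : push (biprod.desc (𝟙 A) (𝟙 A)) (sum ξ ξ) = pull (biprod.desc (𝟙 X) (𝟙 X)) ξ := by
    induction ξ using ind with
    | h S => exact push_eq_pull S.mor_codiag
  rw [add_def, ← pull_sum, ← pull_comp, push_pull, h, ← pull_comp, lift_map, biprod.lift_desc]
  simp

/-- The Yoneda product of a class with a short exact sequence. -/
def splice {X Z A : C} (S : Extension E X Z) : ExtSucc E m Z A → ExtSucc E (m + 1) X A :=
  Quot.map (fun T => ⟨Z, T, S⟩) fun _ _ h => ⟨𝟙 Z, h, Extension.Mor.id S⟩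

lemma splice_push {X Z A A' : C} (S : Extension E X Z) (a : A ⟶ A') (ξ : ExtSucc E m Z A) :
    splice S (push a ξ) = push a (splice S ξ) := by
  induction ξ using ind with
  | h T =>
    have h : ExtSeq.Mor (m := m + 1) ⟨Z, T, S⟩ ⟨Z, T.push a, S⟩ a (𝟙 X) :=
      ⟨𝟙 Z, T.mor_push a, Extension.Mor.id S⟩
    exact ((push_eq_pull h).trans (pull_id _)).symm

lemma splice_pull {X Z X' Z' A : C} {S : Extension E X Z} {S' : Extension E X' Z'} {z : Z ⟶ Z'}
    {c : X ⟶ X'} (hS : S.Mor S' z c) (ξ : ExtSucc E m Z' A) :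
    splice S (pull z ξ) = pull c (splice S' ξ) := by
  induction ξ using ind with
  | h T =>
    have h : ExtSeq.Mor (m := m + 1) ⟨Z, T.pull z, S⟩ ⟨Z', T, S'⟩ (𝟙 A) c :=
      ⟨z, T.pull_mor z, hS⟩
    exact (push_id _).symm.trans (push_eq_pull h)

lemma splice_sum {X Z X' Z' A A' : C} (S : Extension E X Z) (S' : Extension E X' Z')
    (ξ : ExtSucc E m Z A) (ξ' : ExtSucc E m Z' A') :
    splice (S.sum S') (sum ξ ξ') = sum (splice S ξ) (splice S' ξ') := by
  induction ξ using ind with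
  | h T =>
    induction ξ' using ind with
    | h T' => rfl

lemma splice_add {X Z A : C} (S : Extension E X Z) (ξ ξ' : ExtSucc E m Z A) :
    splice S (ξ + ξ') = splice S ξ + splice S ξ' := by
  have h : Extension.Mor S (S.sum S) (biprod.lift (𝟙 Z) (𝟙 Z)) (biprod.lift (𝟙 X) (𝟙 X)) :=
    ExtSeq.mor_diag (m := 0) S
  rw [add_def, add_def, splice_push, splice_pull h, splice_sum]

end ExtSucc

/-- `HExt E A k X` is `Hom(X, A)` for `k = 0` and the Yoneda group `Ext^k(X, A)` for `k ≥ 1`. -/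
def HExt (E : ExactStructure C) (A : C) : ℕ → C → Type (max u v)
  | 0, X => ULift.{u} (X ⟶ A)
  | m + 1, X => ExtSucc E m X A

noncomputable instance (A : C) : ∀ (k : ℕ) (X : C), AddCommGroup (HExt E A k X)
  | 0, X => inferInstanceAs (AddCommGroup (ULift.{u} (X ⟶ A)))
  | m + 1, X => inferInstanceAs (AddCommGroup (ExtSucc E m X A))

namespace HExt

variable {A : C}

/-- The contravariant functoriality of `HExt`. -/
noncomputable def pull : ∀ {k : ℕ} {X X' : C} (_ : X' ⟶ X), HExt E A k X →+ HExt E A k X'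
  | 0, _, _, c => AddMonoidHom.mk' (fun f => ⟨c ≫ f.down⟩) fun _ _ =>
      congrArg ULift.up (Preadditive.comp_add _ _ _ _ _ _)
  | _ + 1, _, _, c => AddMonoidHom.mk' (ExtSucc.pull c) (ExtSucc.pull_add c)

lemma pull_id : ∀ {k : ℕ} {X : C} (ξ : HExt E A k X), pull (𝟙 X) ξ = ξ
  | 0, _, f => congrArg ULift.up (Category.id_comp f.down)
  | _ + 1, _, ξ => ExtSucc.pull_id ξ

lemma pull_comp : ∀ {k : ℕ} {X X' X'' : C} (c : X' ⟶ X) (c' : X'' ⟶ X') (ξ : HExt E A k X),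
    pull (c' ≫ c) ξ = pull c' (pull c ξ)
  | 0, _, _, _, c, c', f => congrArg ULift.up (Category.assoc c' c f.down)
  | _ + 1, _, _, _, c, c', ξ => ExtSucc.pull_comp c c' ξ

lemma pull_zero : ∀ {k : ℕ} {X X' : C} (ξ : HExt E A k X), pull (0 : X' ⟶ X) ξ = 0
  | 0, _, _, _ => congrArg ULift.up zero_comp
  | _ + 1, _, _, ξ => ExtSucc.pull_zero ξ

lemma add_pull : ∀ {k : ℕ} {X X' : C} (c c' : X' ⟶ X) (ξ : HExt E A k X),
    pull (c + c') ξ = pull c ξ + pull c' ξ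
  | 0, _, _, _, _, _ => congrArg ULift.up (Preadditive.add_comp _ _ _ _ _ _)
  | _ + 1, _, _, c, c', ξ => ExtSucc.add_pull c c' ξ

lemma neg_pull {k : ℕ} {X X' : C} (c : X' ⟶ X) (ξ : HExt E A k X) :
    pull (-c) ξ = -pull c ξ := by
  rw [eq_neg_iff_add_eq_zero, ← add_pull, neg_add_cancel, pull_zero]

/-- The connecting map of a short exact sequence. -/
noncomputable def delta {X Z : C} (S : Extension E X Z) :
    ∀ {k : ℕ}, HExt E A k Z →+ HExt E A (k + 1) X
  | 0 => AddMonoidHom.mk' (fun f => ExtSucc.push (m := 0) f.down (ExtSeq.cls (m := 0) S))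
      fun f g => ExtSucc.add_push f.down g.down _
  | _ + 1 => AddMonoidHom.mk' (ExtSucc.splice S) (ExtSucc.splice_add S)

lemma delta_pull {X Z X' Z' : C} {S : Extension E X Z} {S' : Extension E X' Z'} {z : Z ⟶ Z'}
    {c : X ⟶ X'} (h : S.Mor S' z c) : ∀ {k : ℕ} (ξ : HExt E A k Z'),
    delta S (pull z ξ) = pull c (delta S' ξ)
  | 0, f => by
    have e := ExtSucc.push_eq_pull (m := 0) h
    exact ((ExtSucc.push_comp z f.down _).trans (congrArg _ e)).trans (ExtSucc.push_pull _ _ _)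
  | _ + 1, ξ => ExtSucc.splice_pull h ξ

lemma exists_delta : ∀ {k : ℕ} {X : C} (ξ : HExt E A (k + 1) X),
    ∃ (Z : C) (S : Extension E X Z) (ζ : HExt E A k Z), delta S ζ = ξ
  | 0, X, ξ => ExtSucc.ind (P := fun ξ : ExtSucc E 0 X A =>
      ∃ (Z : C) (S : Extension E X Z) (ζ : HExt E A 0 Z), delta S ζ = ξ)
      (fun S => ⟨A, S, ⟨𝟙 A⟩, ExtSucc.push_id (ExtSeq.cls (m := 0) S)⟩) ξ
  | k + 1, X, ξ => ExtSucc.ind (P := fun ξ : ExtSucc E (k + 1) X A =>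
      ∃ (Z : C) (S : Extension E X Z) (ζ : HExt E A (k + 1) Z), delta S ζ = ξ)
      (fun S => ⟨S.1, S.2.2, ExtSeq.cls S.2.1, rfl⟩) ξ

lemma pull_i_pull_p {k : ℕ} {X Z : C} (S : Extension E X Z) (ξ : HExt E A k X) :
    pull S.i (pull S.p ξ) = 0 := by
  rw [← pull_comp, S.w, pull_zero]

lemma delta_pull_i {k : ℕ} {X Z : C} (S : Extension E X Z) (ξ : HExt E A k S.B) :
    delta S (pull S.i ξ) = 0 := by
  rw [delta_pull S.mor_split_zero, pull_zero]

lemma pull_p_delta {k : ℕ} {X Z : C} (S : Extension E X Z) (ξ : HExt E A k Z) :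
    pull S.p (delta S ξ) = 0 := by
  rw [← delta_pull S.split_zero_mor, pull_zero, map_zero]

lemma exists_pull_i_iff_of_mor {k : ℕ}
    (hk : ∀ {X Z : C} (S : Extension E X Z) (ξ : HExt E A k S.B), pull S.i ξ = 0 →
      ∃ ζ : HExt E A k X, pull S.p ζ = ξ)
    {X Z Z' : C} {S : Extension E X Z} {S' : Extension E X Z'} {z : Z ⟶ Z'}
    (h : S.Mor S' z (𝟙 X)) (ξ : HExt E A k Z') :
    (∃ ζ : HExt E A k S.B, pull S.i ζ = pull z ξ) ↔ ∃ ζ : HExt E A k S'.B, pull S'.i ζ = ξ := by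
  obtain ⟨b, h₁, h₂⟩ := h
  constructor
  · rintro ⟨ζ, hζ⟩
    have := E.mono_of_conf S'.conf
    obtain ⟨P, g, p, sq, hp⟩ := E.pullback S.p S'.p ⟨_, _, _, S.conf⟩
    obtain ⟨j, w, hj, hc⟩ := E.conf_pullback S.conf sq hp
    obtain ⟨l, hl⟩ := E.exists_lift S'.conf (p - g ≫ b) (by
      rw [Preadditive.sub_comp, Category.assoc, ← h₂, Category.comp_id, sq.w, sub_self])
    have hjl : j ≫ l = -z := by
      rw [← cancel_mono S'.i, Category.assoc, hl, Preadditive.comp_sub, w, reassoc_of% hj, h₁]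
      simp
    obtain ⟨ζ', hζ'⟩ := hk ⟨P, j, p, w, hc⟩ (pull l ξ + pull g ζ) (by
      dsimp only
      rw [map_add, ← pull_comp, ← pull_comp, hjl, hj, neg_pull, hζ, neg_add_cancel])
    dsimp only at hζ'
    have hw : (0 : Z' ⟶ S.B) ≫ S.p = S'.i ≫ S'.p := by rw [zero_comp, S'.w]
    have hil : sq.lift 0 S'.i hw ≫ l = 𝟙 Z' := by
      simp [← cancel_mono S'.i, hl]
    refine ⟨ζ', ?_⟩
    calc pull S'.i ζ' = pull (sq.lift 0 S'.i hw) (pull p ζ') := by rw [← pull_comp, sq.lift_snd]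
      _ = ξ := by
        rw [hζ', map_add, ← pull_comp, ← pull_comp, hil, sq.lift_fst, pull_id, pull_zero, add_zero]
  · rintro ⟨ζ, rfl⟩
    exact ⟨pull b ζ, by rw [← pull_comp, ← pull_comp, h₁]⟩

lemma exists_pull_i_of_delta_eq_zero_of_exact : ∀ {k : ℕ}
    (_ : ∀ {X Z : C} (S : Extension E X Z) (ξ : HExt E A k S.B), pull S.i ξ = 0 →
      ∃ ζ : HExt E A k X, pull S.p ζ = ξ)
    {X Z : C} (S : Extension E X Z) (ξ : HExt E A k Z), delta S ξ = 0 →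
      ∃ ζ : HExt E A k S.B, pull S.i ζ = ξ
  | 0, _, X, Z, S, f, hf => by
    obtain ⟨T, ⟨b, hb, hb'⟩, -⟩ := S.exists_pushout f.down
    have hT : ExtSeq.cls (m := 0) T = 0 := by
      have e := ExtSucc.push_eq_pull (m := 0) (S := S) (T := T) ⟨b, hb, hb'⟩
      rw [ExtSucc.pull_id] at e
      exact e.symm.trans hf
    obtain ⟨r, hr⟩ := T.cls_eq_zero_iff_exists_retraction.1 hT
    exact ⟨⟨b ≫ r⟩, congrArg ULift.up (by simp [reassoc_of% hb, hr])⟩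
  | m + 1, hk, X, Z, S, ξ, hξ => by
    let P : ExtSeq E (m + 1) X A → Prop := fun U =>
      ∃ ζ : HExt E A (m + 1) U.2.2.B, pull U.2.2.i ζ = ExtSeq.cls U.2.1
    have hP : ∀ U V : ExtSeq E (m + 1) X A, U.Mor V (𝟙 A) (𝟙 X) → P U = P V := by
      rintro U V ⟨z, h₁, h₂⟩
      have e : ExtSeq.cls U.2.1 = pull (k := m + 1) z (ExtSeq.cls V.2.1) := by
        exact (ExtSucc.push_id _).symm.trans (ExtSucc.push_eq_pull h₁)
      have := exists_pull_i_iff_of_mor hk h₂ (ExtSeq.cls V.2.1)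
      rw [← e] at this
      exact propext this
    induction ξ using Quot.ind with
    | mk T =>
      have e := congrArg (Quot.lift P hP) hξ
      have h0 : P (ExtSeq.split E (m + 1) X A) := ⟨0, map_zero _⟩
      exact (iff_of_eq e).2 h0

lemma exists_pull_p : ∀ {k : ℕ} {X Z : C} (S : Extension E X Z) (ξ : HExt E A k S.B),
    pull S.i ξ = 0 → ∃ ζ : HExt E A k X, pull S.p ζ = ξ
  | 0, _, _, S, f, hf => by
    obtain ⟨l, hl⟩ := E.exists_desc S.conf f.down (congrArg ULift.down hf)
    exact ⟨⟨l⟩, congrArg ULift.up hl⟩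
  | k + 1, X, Z, S, ξ, hξ => by
    obtain ⟨N, T, ζ, rfl⟩ := exists_delta ξ
    obtain ⟨U, g, hg, hc, h₁, h₂⟩ := E.exists_preimage T S.conf
    have hUT : U.Mor T (𝟙 N) S.i := ⟨g, by simp [h₁], h₂.symm⟩
    rw [← delta_pull hUT, pull_id] at hξ
    obtain ⟨ζ', rfl⟩ := exists_pull_i_of_delta_eq_zero_of_exact exists_pull_p U ζ hξ
    have hTV : T.Mor ⟨T.B, g, T.p ≫ S.p, hg, hc⟩ U.i S.p := ⟨𝟙 _, by simp [h₁], by simp⟩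
    exact ⟨_, (delta_pull hTV ζ').symm⟩

lemma exists_pull_i {k : ℕ} {X Z : C} (S : Extension E X Z) (ξ : HExt E A k Z)
    (h : delta S ξ = 0) : ∃ ζ : HExt E A k S.B, pull S.i ζ = ξ :=
  exists_pull_i_of_delta_eq_zero_of_exact exists_pull_p S ξ h

end HExt

lemma ExactStructure.epi_codiag (E : ExactStructure C) (X : C) :
    IsAdmissibleEpi E.conf (biprod.desc (𝟙 X) (𝟙 X)) :=
  ⟨X, biprod.lift (𝟙 X) (-𝟙 X), by simp, E.conf_of_iso (ShortComplex.isoMk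
    (S₁ := ShortComplex.mk (biprod.inl : X ⟶ X ⊞ X) biprod.snd (by simp))
    (S₂ := ShortComplex.mk (biprod.lift (𝟙 X) (-𝟙 X)) (biprod.desc (𝟙 X) (𝟙 X)) (by simp))
    (Iso.refl _)
    ⟨biprod.lift biprod.fst (biprod.snd - biprod.fst),
      biprod.lift biprod.fst (biprod.fst + biprod.snd), by ext <;> simp, by ext <;> simp⟩
    (Iso.refl _) (by ext <;> simp) (by ext <;> simp)) (E.conf_split X X)⟩

namespace HExt

variable {A : C}

lemma exists_delta_eq {k : ℕ} {X K : C} (S : Extension E X K) (ξ : HExt E A (k + 1) X)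
    (h : pull S.p ξ = 0) : ∃ ζ : HExt E A k K, delta S ζ = ξ := by
  obtain ⟨N, T, ζ, rfl⟩ := exists_delta ξ
  obtain ⟨G, g, g', sq, hg'⟩ := E.pullback T.p S.p ⟨_, _, _, T.conf⟩
  obtain ⟨j, w, hj, hc⟩ := E.conf_pullback T.conf sq hg'
  have hQT : Extension.Mor ⟨G, j, g', w, hc⟩ T (𝟙 N) S.p := ⟨g, by simp [hj], sq.w.symm⟩
  rw [← delta_pull hQT, pull_id] at h
  obtain ⟨ζ', rfl⟩ := exists_pull_i _ ζ h
  dsimp only at ζ' ⊢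
  have he : biprod.map T.p S.p ≫ biprod.desc (𝟙 X) (𝟙 X) = biprod.desc T.p S.p := by
    ext <;> simp
  have hepi : IsAdmissibleEpi E.conf (biprod.desc T.p S.p) :=
    he ▸ E.epi_comp _ _ ⟨_, _, _, (T.sum S).conf⟩ (E.epi_codiag X)
  have : Mono (biprod.lift g (-g')) := ⟨fun a b e => sq.hom_ext
    (by simpa using e =≫ biprod.fst) (by simpa using e =≫ biprod.snd)⟩
  have hw : biprod.lift g (-g') ≫ biprod.desc T.p S.p = 0 := by simp [sq.w]
  have hW := E.conf_of_isKernel hepi hw fun k hk =>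
    ⟨sq.lift (k ≫ biprod.fst) (-(k ≫ biprod.snd)) (by
      rw [biprod.desc_eq, Preadditive.comp_add] at hk
      simpa [eq_neg_iff_add_eq_zero] using hk), by ext <;> simp⟩
  have hk : (0 : K ⟶ T.B) ≫ T.p = S.i ≫ S.p := by rw [zero_comp, S.w]
  have hTW : T.Mor ⟨_, _, _, _, hW⟩ j (𝟙 X) := ⟨biprod.inl, by
    dsimp only; ext <;> simp [hj, w], by simp⟩
  have hSW : S.Mor ⟨_, _, _, _, hW⟩ (-sq.lift 0 S.i hk) (𝟙 X) := ⟨biprod.inr, by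
    dsimp only; ext <;> simp, by simp⟩
  exact ⟨pull (-sq.lift 0 S.i hk) ζ', by rw [delta_pull hSW, delta_pull hTW]⟩

lemma exact_pull_p_pull_i {k : ℕ} {X Z : C} (S : Extension E X Z) :
    Function.Exact (pull S.p : HExt E A k X →+ _) (pull S.i) := fun ξ =>
  ⟨exists_pull_p S ξ, by rintro ⟨ζ, rfl⟩; exact pull_i_pull_p S ζ⟩

lemma exact_pull_i_delta {k : ℕ} {X Z : C} (S : Extension E X Z) :
    Function.Exact (pull S.i : HExt E A k S.B →+ _) (delta S) := fun ξ =>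
  ⟨exists_pull_i S ξ, by rintro ⟨ζ, rfl⟩; exact delta_pull_i S ζ⟩

lemma exact_delta_pull_p {k : ℕ} {X Z : C} (S : Extension E X Z) :
    Function.Exact (delta S : HExt E A k Z →+ _) (pull S.p) := fun ξ =>
  ⟨exists_delta_eq S ξ, by rintro ⟨ζ, rfl⟩; exact pull_p_delta S ζ⟩

end HExt

end

end LongExactSequence

end ExactCat

namespace ExactCat

section Adjunction

variable {C : Type u} [Category.{v} C] [Preadditive C] [HasBinaryBiproducts C] [HasZeroObject C]
  {D : Type u'} [Category.{v'} D] [Preadditive D] [HasBinaryBiproducts D] [HasZeroObject D]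
  {E : ExactStructure C} {E' : ExactStructure D} {q : C ⥤ D} {t : D ⥤ C}

namespace HExt

/-- The map induced on `HExt` by an exact functor. -/
noncomputable def map [t.Additive] (ht : IsExactFunctor E' E t) {Y : D} :
    ∀ {k : ℕ} {X : D}, HExt E' Y k X →+ HExt E (t.obj Y) k (t.obj X)
  | 0, _ => AddMonoidHom.mk' (fun f => ⟨t.map f.down⟩) fun _ _ => congrArg ULift.up t.map_add
  | _ + 1, _ => AddMonoidHom.mk' (ExtSucc.map ht) (ExtSucc.map_add ht)

lemma map_pull [t.Additive] (ht : IsExactFunctor E' E t) {Y : D} : ∀ {k : ℕ} {X X' : D}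
    (c : X' ⟶ X) (ξ : HExt E' Y k X), map ht (pull c ξ) = pull (t.map c) (map ht ξ)
  | 0, _, _, c, f => congrArg ULift.up (t.map_comp c f.down)
  | _ + 1, _, _, c, ξ => ExtSucc.map_pull ht c ξ

lemma map_delta [t.Additive] (ht : IsExactFunctor E' E t) {Y : D} {X Z : D}
    (S : Extension E' X Z) : ∀ {k : ℕ} (ξ : HExt E' Y k Z),
    map ht (delta S ξ) = delta (S.map ht) (map ht ξ)
  | 0, f => ExtSucc.map_push (m := 0) ht f.down (ExtSeq.cls (m := 0) S)
  | k + 1, ξ => ExtSucc.ind (P := fun ξ : ExtSucc E' k Z Y =>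
      map ht (delta S (k := k + 1) ξ) = delta (S.map ht) (k := k + 1) (map ht (k := k + 1) ξ))
      (fun _ => rfl) ξ

/-- The transformation `Θ`, extended by the adjunction isomorphism in degree zero. -/
noncomputable def theta [t.Additive] (adj : q ⊣ t) (ht : IsExactFunctor E' E t) (Y : D) (k : ℕ)
    (X : C) : HExt E' Y k (q.obj X) →+ HExt E (t.obj Y) k X :=
  (pull (adj.unit.app X)).comp (map ht)

variable [t.Additive] (adj : q ⊣ t) (ht : IsExactFunctor E' E t) {Y : D}

lemma theta_apply {k : ℕ} {X : C} (ξ : HExt E' Y k (q.obj X)) :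
    theta adj ht Y k X ξ = pull (adj.unit.app X) (map ht ξ) := rfl

lemma theta_pull {k : ℕ} {X X' : C} (c : X' ⟶ X) (ξ : HExt E' Y k (q.obj X)) :
    theta adj ht Y k X' (pull (q.map c) ξ) = pull c (theta adj ht Y k X ξ) := by
  simp only [theta_apply, map_pull, ← pull_comp]
  rw [← adj.unit_naturality]

lemma theta_zero_bijective (X : C) : Function.Bijective (theta adj ht Y 0 X) := by
  have : (theta adj ht Y 0 X : HExt E' Y 0 (q.obj X) → HExt E (t.obj Y) 0 X) =
      Equiv.ulift.symm ∘ adj.homEquiv X Y ∘ Equiv.ulift := by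
    ext f
    exact congrArg ULift.up (adj.homEquiv_unit X Y f.down).symm
  rw [this]
  exact Equiv.ulift.symm.bijective.comp ((adj.homEquiv X Y).bijective.comp Equiv.ulift.bijective)

end HExt

/-- Two extensions with the same class after pushout are related by a morphism. -/
lemma Extension.mor_of_push_eq {X Z A : C} {S : Extension E X Z} {V : Extension E X A} {a : Z ⟶ A}
    (h : ExtSucc.push (m := 0) a (ExtSeq.cls (m := 0) S) = ExtSeq.cls (m := 0) V) :
    S.Mor V a (𝟙 X) := by
  have hp : ExtSucc.pull (m := 0) S.p (ExtSeq.cls (m := 0) V) = 0 := by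
    rw [← h]
    exact HExt.pull_p_delta (A := A) S (k := 0) ⟨a⟩
  obtain ⟨W, hW, -⟩ := V.exists_pullback S.p
  have e := ExtSucc.push_eq_pull (m := 0) (S := W) (T := V) hW
  rw [ExtSucc.push_id, hp] at e
  obtain ⟨s, hs⟩ := W.cls_eq_zero_iff_exists_section.1 e
  obtain ⟨b, -, hb⟩ := hW
  obtain ⟨g, hg⟩ : ∃ g : S.B ⟶ V.B, g ≫ V.p = S.p :=
    ⟨s ≫ b, by rw [Category.assoc, ← hb, reassoc_of% hs]⟩
  obtain ⟨z, hz⟩ := E.exists_lift V.conf (S.i ≫ g) (by rw [Category.assoc, hg, S.w])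
  have hz' := ExtSucc.push_eq_pull (m := 0) (S := S) (T := V) (a := z) (c := 𝟙 X)
    ⟨g, hz.symm, by simp [hg]⟩
  rw [ExtSucc.pull_id, ← h] at hz'
  obtain ⟨⟨r⟩, hr⟩ := HExt.exists_pull_i (A := A) S (k := 0) (⟨z⟩ - ⟨a⟩)
    ((map_sub (HExt.delta S (k := 0)) _ _).trans (sub_eq_zero.2 hz'))
  have hr' : S.i ≫ r = z - a := congrArg ULift.down hr
  exact ⟨g - r ≫ V.i, by simp [reassoc_of% hr', hz], by simp [hg, V.w]⟩

variable [q.PreservesZeroMorphisms]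

/-- The image of a short exact sequence which a functor sends to a short exact sequence. -/
def Extension.mapOfConf (q : C ⥤ D) [q.PreservesZeroMorphisms] {X A : C} (S : Extension E X A)
    (h : E'.conf ((ShortComplex.mk S.i S.p S.w).map q)) :
    Extension E' (q.obj X) (q.obj A) where
  B := q.obj S.B
  i := q.map S.i
  p := q.map S.p
  w := by rw [← q.map_comp, S.w, q.map_zero]
  conf := h

section

variable [t.Additive] (adj : q ⊣ t) (ht : IsExactFunctor E' E t) {X A : C} (S : Extension E X A)
  (h : E'.conf ((ShortComplex.mk S.i S.p S.w).map q))

lemma Extension.mor_unit :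
    S.Mor ((S.mapOfConf q h).map ht) (adj.unit.app A) (adj.unit.app X) :=
  ⟨adj.unit.app S.B, by simp [mapOfConf, Extension.map], by simp [mapOfConf, Extension.map]⟩

/-- Transposing a morphism of extensions along an adjunction. -/
lemma Extension.Mor.of_adj {X' A' : D} {T : Extension E' X' A'} {a : A ⟶ t.obj A'}
    {c : X ⟶ t.obj X'} (hS : S.Mor (T.map ht) a c) :
    (S.mapOfConf q h).Mor T ((adj.homEquiv _ _).symm a) ((adj.homEquiv _ _).symm c) := by
  obtain ⟨b, h₁, h₂⟩ := hS
  dsimp only [Extension.map] at b h₁ h₂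
  refine ⟨(adj.homEquiv _ _).symm b, ?_, ?_⟩
  · dsimp only [mapOfConf]
    rw [← adj.homEquiv_naturality_left_symm, h₁, adj.homEquiv_naturality_right_symm]
  · dsimp only [mapOfConf]
    rw [← adj.homEquiv_naturality_left_symm, h₂, adj.homEquiv_naturality_right_symm]

lemma HExt.theta_delta {Y : D} {k : ℕ} (ξ : HExt E' Y k (q.obj A)) :
    theta adj ht Y (k + 1) X (delta (S.mapOfConf q h) ξ) = delta S (theta adj ht Y k A ξ) := by
  rw [theta_apply, theta_apply, map_delta, delta_pull (S.mor_unit adj ht h)]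

end

lemma IsResolving.exists_cover {F : ObjectProperty C} (hF : IsResolving E F) {X N : C}
    (T : Extension E X N) :
    ∃ (K : C) (S : Extension E X K) (z : K ⟶ N), F S.B ∧ S.Mor T z (𝟙 X) := by
  obtain ⟨P, p, hP, hp⟩ := hF.generating T.B
  obtain ⟨K, i, w, h⟩ := E.epi_comp p T.p hp ⟨_, _, _, T.conf⟩
  obtain ⟨z, hz⟩ := E.exists_lift T.conf (i ≫ p) (by simpa using w)
  exact ⟨K, ⟨P, i, p ≫ T.p, w, h⟩, z, hP, p, hz.symm, by simp⟩

section

variable [t.Additive] (adj : q ⊣ t) (ht : IsExactFunctor E' E t)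

open HExt

lemma theta_bijective_of_mem {F : ObjectProperty C} (hF : IsResolving E F)
    (hq : IsExactOn E E' q F) : ∀ (k : ℕ) {X : C} (_ : F X) (Y : D),
    Function.Bijective (theta adj ht Y k X)
  | 0, X, _, Y => theta_zero_bijective adj ht X
  | k + 1, X, hX, Y => by
    have ih {X : C} := theta_bijective_of_mem hF hq k (X := X)
    constructor
    · rw [injective_iff_map_eq_zero]
      intro ξ hξ
      obtain ⟨N, T, ζ, rfl⟩ := exists_delta ξ
      obtain ⟨V, hV, -⟩ := (T.map ht).exists_pullback (X' := X) (adj.unit.app X)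
      obtain ⟨K, S, z, hB, hS⟩ := hF.exists_cover V
      have hK : F K := hF.kernel _ S.conf hB hX
      have h := hq _ S.conf hK hB hX
      have hS' := (Extension.Mor.of_adj adj ht S h (hS.comp hV))
      rw [Category.id_comp, Category.comp_id,
        show (adj.homEquiv X (q.obj X)).symm (adj.unit.app X) = 𝟙 _ by
        simp [Adjunction.homEquiv_counit]] at hS'
      rw [← pull_id (delta T ζ), ← delta_pull hS', theta_delta] at hξ
      obtain ⟨ω, hω⟩ := exists_pull_i S _ hξ
      obtain ⟨ω, rfl⟩ := (ih hB Y).2 ω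
      rw [← theta_pull] at hω
      rw [← pull_id (delta T ζ), ← delta_pull hS', ← (ih hK Y).1 hω]
      exact delta_pull_i (S.mapOfConf q h) ω
    · intro ξ
      obtain ⟨N, T, ζ, rfl⟩ := exists_delta ξ
      obtain ⟨K, S, z, hB, hS⟩ := hF.exists_cover T
      have hK : F K := hF.kernel _ S.conf hB hX
      obtain ⟨ω, hω⟩ := (ih hK Y).2 (pull z ζ)
      exact ⟨delta (S.mapOfConf q (hq _ S.conf hK hB hX)) ω, by
        rw [theta_delta, hω, delta_pull hS, pull_id]⟩

lemma theta_one_injective (X : C) (Y : D) : Function.Injective (theta adj ht Y 1 X) := by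
  rw [injective_iff_map_eq_zero]
  intro ξ
  refine ExtSucc.ind (P := fun ξ : ExtSucc E' 0 (q.obj X) Y =>
    theta adj ht Y 1 X ξ = 0 → ξ = 0) (fun (T : Extension E' (q.obj X) Y) hT => ?_) ξ
  obtain ⟨V, ⟨b, hb, hb'⟩, -⟩ := (T.map ht).exists_pullback (X' := X) (adj.unit.app X)
  have hV : ExtSeq.cls (m := 0) V = 0 := by
    have e := ExtSucc.push_eq_pull (m := 0) (S := V) (T := T.map ht) ⟨b, hb, hb'⟩
    rw [ExtSucc.push_id] at e
    exact e.trans hT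
  obtain ⟨s, hs⟩ := V.cls_eq_zero_iff_exists_section.1 hV
  obtain ⟨s, hs⟩ : ∃ s' : X ⟶ t.obj T.B, s' ≫ t.map T.p = adj.unit.app X :=
    ⟨s ≫ b, ((Category.assoc _ _ _).trans (congrArg _ hb'.symm)).trans (by rw [reassoc_of% hs])⟩
  exact T.cls_eq_zero_iff_exists_section.2 ⟨(adj.homEquiv _ _).symm s, by
    rw [← adj.homEquiv_naturality_right_symm, hs]; simp [Adjunction.homEquiv_counit]⟩

lemma mono_map_i_of_theta_one_surjective {X Z : C} (S : Extension E X Z)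
    (h : Function.Surjective (theta adj ht (q.obj Z) 1 X)) : Mono (q.map S.i) := by
  obtain ⟨ξ, hξ⟩ := h (ExtSucc.push (m := 0) (adj.unit.app Z) (ExtSeq.cls (m := 0) S))
  revert hξ
  refine ExtSucc.ind (P := fun ξ : ExtSucc E' 0 (q.obj X) (q.obj Z) =>
    theta adj ht (q.obj Z) 1 X ξ = ExtSucc.push (m := 0) (adj.unit.app Z)
      (ExtSeq.cls (m := 0) S) → Mono (q.map S.i))
    (fun (U : Extension E' (q.obj X) (q.obj Z)) hU => ?_) ξ
  obtain ⟨V, hV, -⟩ := (U.map ht).exists_pullback (X' := X) (adj.unit.app X)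
  have e := ExtSucc.push_eq_pull (m := 0) (S := V) (T := U.map ht) hV
  rw [ExtSucc.push_id] at e
  obtain ⟨b, hb, -⟩ := (Extension.mor_of_push_eq (e.trans hU).symm).comp hV
  obtain ⟨b, hb'⟩ : ∃ b' : S.B ⟶ t.obj U.B, S.i ≫ b' = adj.unit.app Z ≫ t.map U.i :=
    ⟨b, hb.trans (congrArg (· ≫ _) (Category.comp_id _))⟩
  have := E'.mono_of_conf U.conf
  have hU' : q.map S.i ≫ (adj.homEquiv _ _).symm b = U.i := by
    rw [← adj.homEquiv_naturality_left_symm, hb', adj.homEquiv_naturality_right_symm]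
    simp [Adjunction.homEquiv_counit]
  have : Mono (q.map S.i ≫ (adj.homEquiv _ _).symm b) := hU' ▸ this
  exact mono_of_mono _ ((adj.homEquiv _ _).symm b)

section FiveLemma

variable {X Z : C} (S : Extension E X Z) (h : E'.conf ((ShortComplex.mk S.i S.p S.w).map q)) {Y : D}
  (hS : ∀ k, Function.Bijective (theta adj ht Y k S.B))

lemma theta_pull_i_comp (k : ℕ) : (pull S.i).comp (theta adj ht Y k S.B) =
    (theta adj ht Y k Z).comp (pull (S.mapOfConf q h).i) :=
  AddMonoidHom.ext fun ξ => (theta_pull adj ht S.i ξ).symm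

lemma theta_pull_p_comp (k : ℕ) : (pull S.p).comp (theta adj ht Y k X) =
    (theta adj ht Y k S.B).comp (pull (S.mapOfConf q h).p) :=
  AddMonoidHom.ext fun ξ => (theta_pull adj ht S.p ξ).symm

lemma theta_delta_comp (k : ℕ) : (delta S).comp (theta adj ht Y k Z) =
    (theta adj ht Y (k + 1) X).comp (delta (S.mapOfConf q h)) :=
  AddMonoidHom.ext fun ξ => (theta_delta adj ht S h ξ).symm

include h hS

lemma theta_succ_injective (k : ℕ) (hZ : Function.Injective (theta adj ht Y k Z)) :
    Function.Injective (theta adj ht Y (k + 1) X) :=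
  AddMonoidHom.injective_of_surjective_of_injective_of_injective _ _ _ _ _ _ _ _ _ _
    (theta_pull_i_comp adj ht S h k) (theta_delta_comp adj ht S h k)
    (theta_pull_p_comp adj ht S h (k + 1)) (exact_pull_i_delta _) (exact_delta_pull_p _)
    (exact_pull_i_delta _) (hS k).2 hZ (hS (k + 1)).1

lemma theta_succ_bijective (k : ℕ) (hZ : Function.Bijective (theta adj ht Y k Z))
    (hZ' : Function.Injective (theta adj ht Y (k + 1) Z)) :
    Function.Bijective (theta adj ht Y (k + 1) X) :=
  AddMonoidHom.bijective_of_surjective_of_bijective_of_bijective_of_injective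
    _ _ _ _ _ _ _ _ _ _ _ _ _
    (theta_pull_i_comp adj ht S h k) (theta_delta_comp adj ht S h k)
    (theta_pull_p_comp adj ht S h (k + 1)) (theta_pull_i_comp adj ht S h (k + 1))
    (exact_pull_i_delta _) (exact_delta_pull_p _) (exact_pull_p_pull_i _)
    (exact_pull_i_delta _) (exact_delta_pull_p _) (exact_pull_p_pull_i _)
    (hS k).2 hZ (hS (k + 1)) hZ'

lemma theta_syzygy_bijective (k : ℕ) (hX : Function.Bijective (theta adj ht Y k X))
    (hX' : Function.Bijective (theta adj ht Y (k + 1) X)) :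
    Function.Bijective (theta adj ht Y k Z) :=
  AddMonoidHom.bijective_of_surjective_of_bijective_of_bijective_of_injective
    _ _ _ _ _ _ _ _ _ _ _ _ _
    (theta_pull_p_comp adj ht S h k) (theta_pull_i_comp adj ht S h k)
    (theta_delta_comp adj ht S h k) (theta_pull_p_comp adj ht S h (k + 1))
    (exact_pull_p_pull_i _) (exact_pull_i_delta _) (exact_delta_pull_p _)
    (exact_pull_p_pull_i _) (exact_pull_i_delta _) (exact_delta_pull_p _)
    hX.2 (hS k) hX' (hS (k + 1)).1

end FiveLemma

section Syzygies

variable {F : ObjectProperty C} (hF : IsResolving E F) (hq : IsExactOn E E' q F)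
  (hE : ∀ S : ShortComplex C, E.conf S → Mono (q.map S.f) → E'.conf (S.map q))

include hF hq hE

lemma theta_bijective_of_mono : ∀ (n : ℕ) (Z : ℕ → C) (U : ∀ k, Extension E (Z k) (Z (k + 1)))
    (_ : ∀ k, F (U k).B) (_ : ∀ k < n, Mono (q.map (U k).i)) (Y : D),
    (∀ k ≤ n, Function.Bijective (theta adj ht Y k (Z 0))) ∧
      Function.Injective (theta adj ht Y (n + 1) (Z 0))
  | 0, Z, _, _, _, Y => ⟨fun k hk => by
      obtain rfl := Nat.le_zero.1 hk
      exact theta_zero_bijective adj ht (Z 0), theta_one_injective adj ht (Z 0) Y⟩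
  | n + 1, Z, U, hU, hm, Y => by
    obtain ⟨ih₁, ih₂⟩ := theta_bijective_of_mono n (fun k => Z (k + 1)) (fun k => U (k + 1))
      (fun k => hU (k + 1)) (fun k hk => hm (k + 1) (by omega)) Y
    have h := hE _ (U 0).conf (hm 0 (by omega))
    have hS k := theta_bijective_of_mem adj ht hF hq k (hU 0) Y
    refine ⟨fun k hk => ?_, theta_succ_injective adj ht (U 0) h hS (n + 1) ih₂⟩
    obtain _ | k := k
    · exact theta_zero_bijective adj ht (Z 0)
    · refine theta_succ_bijective adj ht (U 0) h hS k (ih₁ k (by omega)) ?_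
      obtain hk | rfl : k + 1 ≤ n ∨ k = n := by omega
      · exact (ih₁ _ hk).1
      · exact ih₂

lemma mono_of_theta_bijective : ∀ (n : ℕ) (Z : ℕ → C) (U : ∀ k, Extension E (Z k) (Z (k + 1)))
    (_ : ∀ k, F (U k).B) (_ : ∀ k ≤ n, ∀ Y : D, Function.Bijective (theta adj ht Y k (Z 0))),
    ∀ k < n, Mono (q.map (U k).i)
  | 0, _, _, _, _, k, hk => absurd hk (Nat.not_lt_zero k)
  | n + 1, Z, U, hU, hn, k, hk => by
    have h₀ := mono_map_i_of_theta_one_surjective adj ht (U 0) (hn 1 (by omega) _).2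
    obtain _ | k := k
    · exact h₀
    · refine mono_of_theta_bijective n (fun k => Z (k + 1)) (fun k => U (k + 1))
        (fun k => hU (k + 1)) (fun k hk Y => ?_) k (by omega)
      exact theta_syzygy_bijective adj ht (U 0) (hE _ (U 0).conf h₀)
        (fun k => theta_bijective_of_mem adj ht hF hq k (hU 0) Y) k (hn k (by omega) Y)
        (hn (k + 1) (by omega) Y)

end Syzygies

lemma theta_bijective_of_iso {k : ℕ} {X X' : C} (e : X ≅ X') {Y : D}
    (h : Function.Bijective (theta adj ht Y k X)) :
    Function.Bijective (theta adj ht Y k X') := by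
  have hC : Function.Bijective (pull e.inv : HExt E (t.obj Y) k X →+ _) :=
    Function.bijective_iff_has_inverse.2 ⟨pull e.hom, fun ξ => by simp [← pull_comp, pull_id],
      fun ξ => by simp [← pull_comp, pull_id]⟩
  have hD : Function.Bijective (pull (q.map e.hom) : HExt E' Y k (q.obj X') →+ _) :=
    Function.bijective_iff_has_inverse.2 ⟨pull (q.map e.inv), fun ξ => by
      simp [← pull_comp, pull_id, ← q.map_comp], fun ξ => by
      simp [← pull_comp, pull_id, ← q.map_comp]⟩
  have : (theta adj ht Y k X' : _ → HExt E (t.obj Y) k X') =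
      pull e.inv ∘ theta adj ht Y k X ∘ pull (q.map e.hom) := by
    ext ξ
    simp [theta_pull, ← pull_comp, pull_id]
  rw [this]
  exact hC.comp (h.comp hD)

/-- The comparison theorem for an adjoint pair of functors between exact categories, with the
vanishing of relative derived functors expressed through the syzygies of a resolution. -/
theorem mono_iff_thetaSucc_bijective {F : ObjectProperty C} (hF : IsResolving E F)
    (hq : IsExactOn E E' q F)
    (hE : ∀ S : ShortComplex C, E.conf S → Mono (q.map S.f) → E'.conf (S.map q))
    (n : ℕ) (X : C) (Z : ℕ → C) (U : ∀ k, Extension E (Z k) (Z (k + 1)))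
    (hU : ∀ k, F (U k).B) (e : Z 0 ≅ X) :
    (∀ k < n, Mono (q.map (U k).i)) ↔
      ∀ k < n, ∀ Y : D, Function.Bijective (thetaSucc adj ht k X Y) := by
  constructor
  · intro h k hk Y
    exact theta_bijective_of_iso adj ht e
      ((theta_bijective_of_mono adj ht hF hq hE n Z U hU h Y).1 (k + 1) hk)
  · intro h
    refine mono_of_theta_bijective adj ht hF hq hE n Z U hU fun k hk Y => ?_
    obtain _ | k := k
    · exact theta_zero_bijective adj ht (Z 0)
    · exact theta_bijective_of_iso adj ht e.symm (h k hk Y)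

end

end Adjunction

end ExactCat

namespace ExactCat

open Opposite

section Opposite

variable {C : Type u} [Category.{v} C] [Preadditive C] {E : ExactStructure C}

lemma isAdmissibleMono_op_iff (P : ObjectProperty (ShortComplex C)) {X Y : Cᵒᵖ} (i : X ⟶ Y) :
    IsAdmissibleMono (fun S : ShortComplex Cᵒᵖ => P S.unop) i ↔ IsAdmissibleEpi P i.unop :=
  ⟨fun ⟨Z, p, w, h⟩ => ⟨unop Z, p.unop, by rw [← unop_comp, w, unop_zero], h⟩,
    fun ⟨Z, p, w, h⟩ => ⟨op Z, p.op, Quiver.Hom.unop_inj (by simpa using w), h⟩⟩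

lemma isAdmissibleEpi_op_iff (P : ObjectProperty (ShortComplex C)) {X Y : Cᵒᵖ} (p : X ⟶ Y) :
    IsAdmissibleEpi (fun S : ShortComplex Cᵒᵖ => P S.unop) p ↔ IsAdmissibleMono P p.unop :=
  ⟨fun ⟨Z, i, w, h⟩ => ⟨unop Z, i.unop, by rw [← unop_comp, w, unop_zero], h⟩,
    fun ⟨Z, i, w, h⟩ => ⟨op Z, i.op, Quiver.Hom.unop_inj (by simpa using w), h⟩⟩

/-- The opposite exact structure. -/
def ExactStructure.op (E : ExactStructure C) : ExactStructure Cᵒᵖ where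
  conf S := E.conf S.unop
  conf_of_iso e h := E.conf_of_iso ⟨ShortComplex.unopMap e.inv, ShortComplex.unopMap e.hom,
    congrArg ShortComplex.unopMap e.hom_inv_id, congrArg ShortComplex.unopMap e.inv_hom_id⟩ h
  isKernel S h := by
    obtain ⟨hc⟩ := E.isCokernel _ h
    exact ⟨CokernelCofork.IsColimit.ofπOp _ _ hc⟩
  isCokernel S h := by
    obtain ⟨hc⟩ := E.isKernel _ h
    exact ⟨KernelFork.IsLimit.ofιOp _ _ hc⟩
  mono_id X := (isAdmissibleMono_op_iff _ _).2 (E.epi_id _)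
  epi_id X := (isAdmissibleEpi_op_iff _ _).2 (E.mono_id _)
  mono_comp i j hi hj := (isAdmissibleMono_op_iff _ _).2 (E.epi_comp _ _
    ((isAdmissibleMono_op_iff _ _).1 hj) ((isAdmissibleMono_op_iff _ _).1 hi))
  epi_comp i j hi hj := (isAdmissibleEpi_op_iff _ _).2 (E.mono_comp _ _
    ((isAdmissibleEpi_op_iff _ _).1 hj) ((isAdmissibleEpi_op_iff _ _).1 hi))
  pushout i f hi := by
    obtain ⟨Y, g, p, sq, hp⟩ := E.pullback i.unop f.unop ((isAdmissibleMono_op_iff _ _).1 hi)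
    exact ⟨_, g.op, p.op, sq.op.flip, (isAdmissibleMono_op_iff _ _).2 hp⟩
  pullback p f hp := by
    obtain ⟨Y, g, i, sq, hi⟩ := E.pushout p.unop f.unop ((isAdmissibleEpi_op_iff _ _).1 hp)
    exact ⟨_, g.op, i.op, sq.op.flip, (isAdmissibleEpi_op_iff _ _).2 hi⟩

/-- The opposite of a short exact sequence. -/
def Extension.op {X A : C} (S : Extension E X A) : Extension E.op (Opposite.op A)
    (Opposite.op X) where
  B := Opposite.op S.B
  i := S.p.op
  p := S.i.op
  w := by rw [← op_comp, S.w, op_zero]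
  conf := S.conf

/-- The short exact sequence whose opposite is a given one. -/
def Extension.unop {X A : Cᵒᵖ} (S : Extension E.op X A) :
    Extension E (Opposite.unop A) (Opposite.unop X) where
  B := Opposite.unop S.B
  i := S.p.unop
  p := S.i.unop
  w := by rw [← unop_comp, S.w, unop_zero]
  conf := S.conf

lemma Extension.Mor.op {X A X' A' : C} {S : Extension E X A} {T : Extension E X' A'} {a : A ⟶ A'}
    {c : X ⟶ X'} (h : S.Mor T a c) : T.op.Mor S.op c.op a.op := by
  obtain ⟨b, h₁, h₂⟩ := h
  exact ⟨b.op, congrArg Quiver.Hom.op h₂.symm, congrArg Quiver.Hom.op h₁.symm⟩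

lemma Extension.Mor.unop {X A X' A' : Cᵒᵖ} {S : Extension E.op X A} {T : Extension E.op X' A'}
    {a : A ⟶ A'} {c : X ⟶ X'} (h : S.Mor T a c) : T.unop.Mor S.unop c.unop a.unop := by
  obtain ⟨b, h₁, h₂⟩ := h
  exact ⟨b.unop, congrArg Quiver.Hom.unop h₂.symm, congrArg Quiver.Hom.unop h₁.symm⟩

namespace ExtSeq

/-- Splicing a short exact sequence to the left end of an exact sequence. -/
def snoc : ∀ {m : ℕ} {X Z A : C}, ExtSeq E m X Z → Extension E Z A → ExtSeq E (m + 1) X A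
  | 0, _, Z, _, S, T => ⟨Z, T, S⟩
  | _ + 1, _, _, _, S, T => ⟨S.1, snoc S.2.1 T, S.2.2⟩

lemma Mor.snoc : ∀ {m : ℕ} {X Z A X' Z' A' : C} {S : ExtSeq E m X Z} {S' : ExtSeq E m X' Z'}
    {T : Extension E Z A} {T' : Extension E Z' A'} {a : A ⟶ A'} {z : Z ⟶ Z'} {c : X ⟶ X'},
    S.Mor S' z c → T.Mor T' a z → (S.snoc T).Mor (S'.snoc T') a c
  | 0, _, _, _, _, _, _, _, _, _, _, _, z, _, h, h' => ⟨z, h', h⟩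
  | _ + 1, _, _, _, _, _, _, _, _, _, _, _, _, _, ⟨w, h₁, h₂⟩, h' => ⟨w, Mor.snoc h₁ h', h₂⟩

/-- The opposite of an exact sequence. -/
def op : ∀ {m : ℕ} {X A : C}, ExtSeq E m X A → ExtSeq E.op m (Opposite.op A) (Opposite.op X)
  | 0, _, _, S => Extension.op S
  | _ + 1, _, _, S => snoc (op S.2.1) S.2.2.op

/-- The exact sequence whose opposite is a given one. -/
def unop : ∀ {m : ℕ} {X A : Cᵒᵖ}, ExtSeq E.op m X A →
    ExtSeq E m (Opposite.unop A) (Opposite.unop X)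
  | 0, _, _, S => Extension.unop S
  | _ + 1, _, _, S => snoc (unop S.2.1) S.2.2.unop

lemma Mor.op : ∀ {m : ℕ} {X A X' A' : C} {S : ExtSeq E m X A} {T : ExtSeq E m X' A'}
    {a : A ⟶ A'} {c : X ⟶ X'}, S.Mor T a c → (ExtSeq.op T).Mor (ExtSeq.op S) c.op a.op
  | 0, _, _, _, _, _, _, _, _, h => Extension.Mor.op h
  | _ + 1, _, _, _, _, _, _, _, _, ⟨_, h₁, h₂⟩ => Mor.snoc (Mor.op h₁) h₂.op

lemma Mor.unop : ∀ {m : ℕ} {X A X' A' : Cᵒᵖ} {S : ExtSeq E.op m X A} {T : ExtSeq E.op m X' A'}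
    {a : A ⟶ A'} {c : X ⟶ X'}, S.Mor T a c → (ExtSeq.unop T).Mor (ExtSeq.unop S) c.unop a.unop
  | 0, _, _, _, _, _, _, _, _, h => Extension.Mor.unop h
  | _ + 1, _, _, _, _, _, _, _, _, ⟨_, h₁, h₂⟩ => Mor.snoc (Mor.unop h₁) h₂.unop

lemma op_snoc : ∀ {m : ℕ} {X Z A : C} (S : ExtSeq E m X Z) (T : Extension E Z A),
    op (snoc S T) = ⟨Opposite.op Z, op S, T.op⟩
  | 0, _, _, _, _, _ => rfl
  | _ + 1, _, _, _, S, T => congrArg (fun R => snoc R S.2.2.op) (op_snoc S.2.1 T)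

lemma unop_snoc : ∀ {m : ℕ} {X Z A : Cᵒᵖ} (S : ExtSeq E.op m X Z) (T : Extension E.op Z A),
    unop (snoc S T) = ⟨Opposite.unop Z, unop S, T.unop⟩
  | 0, _, _, _, _, _ => rfl
  | _ + 1, _, _, _, S, T => congrArg (fun R => snoc R S.2.2.unop) (unop_snoc S.2.1 T)

lemma unop_op : ∀ {m : ℕ} {X A : C} (S : ExtSeq E m X A), unop (op S) = S
  | 0, _, _, _ => rfl
  | m + 1, X, A, S => (unop_snoc (op S.2.1) S.2.2.op).trans
      (congrArg (fun R => (⟨S.1, R, S.2.2⟩ : ExtSeq E (m + 1) X A)) (unop_op S.2.1))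

lemma op_unop : ∀ {m : ℕ} {X A : Cᵒᵖ} (S : ExtSeq E.op m X A), op (unop S) = S
  | 0, _, _, _ => rfl
  | m + 1, X, A, S => (op_snoc (unop S.2.1) S.2.2.unop).trans
      (congrArg (fun R => (⟨S.1, R, S.2.2⟩ : ExtSeq E.op (m + 1) X A)) (op_unop S.2.1))

end ExtSeq

namespace ExtSucc

/-- Taking opposites of exact sequences is a bijection on extension classes. -/
def opEquiv (m : ℕ) (X A : C) :
    ExtSucc E m X A ≃ ExtSucc E.op m (Opposite.op A)
    (Opposite.op X) where
  toFun := Quot.lift (fun S => (ExtSeq.op S).cls) fun _ _ h => (ExtSeq.cls_eq h.op).symm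
  invFun := Quot.lift (fun S => (ExtSeq.unop S).cls) fun _ _ h => (ExtSeq.cls_eq h.unop).symm
  left_inv := ind fun S => congrArg ExtSeq.cls S.unop_op
  right_inv := ind fun S => congrArg ExtSeq.cls S.op_unop

lemma opEquiv_push {m : ℕ} {X A A' : C} (a : A ⟶ A') (ξ : ExtSucc E m X A) :
    opEquiv m X A' (push a ξ) = pull a.op (opEquiv m X A ξ) := by
  induction ξ using ind with
  | h S => exact (push_id _).symm.trans (push_eq_pull (S.mor_push a).op)

end ExtSucc

end Opposite

section OppositeFunctor

variable {C : Type u} [Category.{v} C] [Preadditive C] {D : Type u'} [Category.{v'} D]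
  [Preadditive D] {E : ExactStructure C} {E' : ExactStructure D} {q : C ⥤ D} {t : D ⥤ C}

lemma IsExactFunctor.op [q.Additive] (hq : IsExactFunctor E E' q) :
    IsExactFunctor E.op E'.op q.op := fun S hS => hq S.unop hS

lemma IsExactOn.op [q.Additive] {P : ObjectProperty C} (hq : IsExactOn E E' q P) :
    IsExactOn E.op E'.op q.op P.op := fun S hS h₁ h₂ h₃ => hq S.unop hS h₃ h₂ h₁

lemma IsCoresolving.op {G : ObjectProperty C} (hG : IsCoresolving E G) :
    IsResolving E.op G.op where
  extension S hS h₁ h₃ := hG.extension S.unop hS h₃ h₁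
  generating X := by
    obtain ⟨I, i, hI, hi⟩ := hG.cogenerating X.unop
    exact ⟨Opposite.op I, i.op, hI, (isAdmissibleEpi_op_iff _ _).2 hi⟩
  kernel S hS h₂ h₃ := hG.cokernel S.unop hS h₃ h₂

lemma ExtSeq.map_snoc [q.Additive] (hq : IsExactFunctor E E' q) :
    ∀ {m : ℕ} {X Z A : C} (S : ExtSeq E m X Z) (T : Extension E Z A),
      (S.snoc T).map hq = (S.map hq).snoc (T.map hq)
  | 0, _, _, _, _, _ => rfl
  | m + 1, X, _, A, S, T => congrArg
      (fun R => (⟨q.obj S.1, R, S.2.2.map hq⟩ : ExtSeq E' (m + 2) (q.obj X) (q.obj A)))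
      (map_snoc hq S.2.1 T)

lemma ExtSeq.op_map [q.Additive] (hq : IsExactFunctor E E' q) :
    ∀ {m : ℕ} {X A : C} (S : ExtSeq E m X A), op (S.map hq) = (op S).map hq.op
  | 0, _, _, _ => rfl
  | _ + 1, _, _, S => (congrArg (fun R => snoc R (S.2.2.map hq).op) (op_map hq S.2.1)).trans
      (map_snoc hq.op (op S.2.1) S.2.2.op).symm

variable [HasBinaryBiproducts C] [HasZeroObject C] [HasBinaryBiproducts D] [HasZeroObject D]

lemma opEquiv_omegaSucc [q.Additive] [HasBinaryBiproducts Cᵒᵖ] [HasBinaryBiproducts Dᵒᵖ]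
    (adj : q ⊣ t) (hq : IsExactFunctor E E' q) (m : ℕ)
    (X : C) (Y : D) (ξ : ExtSucc E m X (t.obj Y)) :
    ExtSucc.opEquiv m (q.obj X) Y (omegaSucc adj hq m X Y ξ) =
      thetaSucc adj.op hq.op m (op Y) (op X) (ExtSucc.opEquiv m X (t.obj Y) ξ) := by
  induction ξ using ExtSucc.ind with
  | h S =>
    exact (ExtSucc.opEquiv_push (adj.counit.app Y) (ExtSeq.cls (ExtSeq.map hq S))).trans
      (congrArg (fun R => ExtSucc.pull (adj.counit.app Y).op (ExtSeq.cls R)) (S.op_map hq))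

lemma omegaSucc_bijective_iff [q.Additive] [HasBinaryBiproducts Cᵒᵖ] [HasBinaryBiproducts Dᵒᵖ]
    (adj : q ⊣ t) (hq : IsExactFunctor E E' q) (m : ℕ) (X : C) (Y : D) :
    Function.Bijective (omegaSucc adj hq m X Y) ↔
      Function.Bijective (thetaSucc adj.op hq.op m (op Y) (op X)) := by
  have h : ExtSucc.opEquiv m (q.obj X) Y ∘ omegaSucc adj hq m X Y =
      thetaSucc adj.op hq.op m (op Y) (op X) ∘ ExtSucc.opEquiv m X (t.obj Y) :=
    funext (opEquiv_omegaSucc adj hq m X Y)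
  rw [← Function.Bijective.of_comp_iff' (ExtSucc.opEquiv m (q.obj X) Y).bijective, h,
    Function.Bijective.of_comp_iff _ (ExtSucc.opEquiv m X (t.obj Y)).bijective]

end OppositeFunctor

end ExactCat

namespace ExactCat

section Homology

variable {A : Type u} [Category.{v} A] [Abelian A] {X₁ Y₁ X₂ Y₂ X₃ : A}

lemma exact_iff_mono_of_epi (e : X₁ ⟶ Y₁) (i : Y₁ ⟶ X₂) (p : X₂ ⟶ Y₂) (j : Y₂ ⟶ X₃) [Epi e]
    [Epi p] (w : i ≫ p = 0) (h : (ShortComplex.mk i p w).Exact) (w' : (e ≫ i) ≫ p ≫ j = 0) :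
    (ShortComplex.mk (e ≫ i) (p ≫ j) w').Exact ↔ Mono j := by
  constructor
  · intro hx
    refine Preadditive.mono_of_cancel_zero j fun {T} x hxj => ?_
    obtain ⟨T', π, _, y, hy⟩ := surjective_up_to_refinements_of_epi p x
    obtain ⟨T'', π', _, z, hz⟩ := hx.exact_up_to_refinements y (by
      dsimp only
      rw [← Category.assoc, ← hy, Category.assoc, hxj, comp_zero])
    dsimp only at hz
    rw [← cancel_epi π, ← cancel_epi π', hy, reassoc_of% hz, w]
    simp
  · intro _
    let φ : ShortComplex.mk (e ≫ i) p (by simp [w]) ⟶ ShortComplex.mk i p w :=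
      ⟨e, 𝟙 _, 𝟙 _, by simp, by simp⟩
    let ψ : ShortComplex.mk (e ≫ i) p (by simp [w]) ⟶ ShortComplex.mk (e ≫ i) (p ≫ j) w' :=
      ⟨𝟙 _, 𝟙 _, j, by simp, by simp⟩
    have : Epi φ.τ₁ := ‹Epi e›
    have : IsIso φ.τ₂ := inferInstanceAs (IsIso (𝟙 _))
    have : Mono φ.τ₃ := inferInstanceAs (Mono (𝟙 _))
    have : Epi ψ.τ₁ := inferInstanceAs (Epi (𝟙 _))
    have : IsIso ψ.τ₂ := inferInstanceAs (IsIso (𝟙 _))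
    have : Mono ψ.τ₃ := ‹Mono j›
    rwa [← ShortComplex.exact_iff_of_epi_of_isIso_of_mono ψ,
      ShortComplex.exact_iff_of_epi_of_isIso_of_mono φ]

lemma exact_iff_epi_of_mono (e : X₁ ⟶ Y₁) (i : Y₁ ⟶ X₂) (p : X₂ ⟶ Y₂) (j : Y₂ ⟶ X₃) [Mono i]
    [Mono j] (w : i ≫ p = 0) (h : (ShortComplex.mk i p w).Exact) (w' : (e ≫ i) ≫ p ≫ j = 0) :
    (ShortComplex.mk (e ≫ i) (p ≫ j) w').Exact ↔ Epi e := by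
  constructor
  · intro hx
    obtain ⟨T, π, _, y, hy⟩ := hx.exact_up_to_refinements i (by simp [reassoc_of% w])
    dsimp only at y hy
    have hπ : π = y ≫ e := by rw [← cancel_mono i, hy, Category.assoc]
    have : Epi (y ≫ e) := hπ ▸ ‹Epi π›
    exact epi_of_epi y e
  · intro _
    let φ : ShortComplex.mk (e ≫ i) p (by simp [w]) ⟶ ShortComplex.mk i p w :=
      ⟨e, 𝟙 _, 𝟙 _, by simp, by simp⟩
    let ψ : ShortComplex.mk (e ≫ i) p (by simp [w]) ⟶ ShortComplex.mk (e ≫ i) (p ≫ j) w' :=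
      ⟨𝟙 _, 𝟙 _, j, by simp, by simp⟩
    have : Epi φ.τ₁ := ‹Epi e›
    have : IsIso φ.τ₂ := inferInstanceAs (IsIso (𝟙 _))
    have : Mono φ.τ₃ := inferInstanceAs (Mono (𝟙 _))
    have : Epi ψ.τ₁ := inferInstanceAs (Epi (𝟙 _))
    have : IsIso ψ.τ₂ := inferInstanceAs (IsIso (𝟙 _))
    have : Mono ψ.τ₃ := ‹Mono j›
    rwa [← ShortComplex.exact_iff_of_epi_of_isIso_of_mono ψ,
      ShortComplex.exact_iff_of_epi_of_isIso_of_mono φ]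

end Homology

section DerivedFunctors

variable {C : Type u} [Category.{v} C] [Preadditive C] {E : ExactStructure C}
  {A : Type u'} [Category.{v'} A] [Abelian A]

lemma exact_map_of_leftAdjoint {q : C ⥤ A} {t : A ⥤ C} [q.PreservesZeroMorphisms] (adj : q ⊣ t)
    {S : ShortComplex C} (hS : E.conf S) : (S.map q).Exact := by
  have := adj.leftAdjoint_preservesColimits
  obtain ⟨hc⟩ := E.isCokernel S hS
  exact ShortComplex.exact_of_g_is_cokernel _ (CokernelCofork.mapIsColimit _ hc q)

lemma exact_map_of_rightAdjoint {q : A ⥤ C} {t : C ⥤ A} [t.PreservesZeroMorphisms] (adj : q ⊣ t)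
    {S : ShortComplex C} (hS : E.conf S) : (S.map t).Exact := by
  have := adj.rightAdjoint_preservesLimits
  obtain ⟨hc⟩ := E.isKernel S hS
  exact ShortComplex.exact_of_f_is_kernel _ (KernelFork.mapIsLimit _ hc t)

lemma epi_map_of_leftAdjoint {q : C ⥤ A} {t : A ⥤ C} (adj : q ⊣ t)
    {S : ShortComplex C} (hS : E.conf S) : Epi (q.map S.g) := by
  have := adj.leftAdjoint_preservesColimits
  have := E.epi_of_conf (i := S.f) (p := S.g) hS
  infer_instance

lemma mono_map_of_rightAdjoint {q : A ⥤ C} {t : C ⥤ A} (adj : q ⊣ t)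
    {S : ShortComplex C} (hS : E.conf S) : Mono (t.map S.f) := by
  have := adj.rightAdjoint_preservesLimits
  have := E.mono_of_conf (i := S.f) (p := S.g) hS
  infer_instance

lemma isZero_leftDerived_succ_iff {q : C ⥤ A} {t : A ⥤ C} [q.PreservesZeroMorphisms] (adj : q ⊣ t)
    {F : ObjectProperty C} {X : C} (P : Resolution E F X) (k : ℕ) :
    IsZero (leftDerived q P (k + 1)) ↔ Mono (q.map (P.i k)) := by
  have h₁ : Epi (q.map (P.p (k + 2))) := epi_map_of_leftAdjoint adj (P.conf (k + 2))
  have h₂ : Epi (q.map (P.p (k + 1))) := epi_map_of_leftAdjoint adj (P.conf (k + 1))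
  rw [leftDerived, ← HomologicalComplex.exactAt_iff_isZero_homology,
    HomologicalComplex.exactAt_iff' _ (k + 2) (k + 1) k (by simp) (by simp),
    ← exact_iff_mono_of_epi (q.map (P.p (k + 2))) (q.map (P.i (k + 1))) (q.map (P.p (k + 1)))
      (q.map (P.i k)) (by rw [← q.map_comp, P.w, q.map_zero])
      (exact_map_of_leftAdjoint adj (P.conf (k + 1)))
      (by simp only [← q.map_comp, Category.assoc, reassoc_of% (P.w (k + 1))]; simp)]
  exact ShortComplex.exact_iff_of_iso (ShortComplex.isoMk (Iso.refl _) (Iso.refl _) (Iso.refl _)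
    ((Category.id_comp _).trans (((congrArg q.map (P.d_eq _)).trans (q.map_comp _ _)).symm.trans
      (Category.comp_id _).symm))
    ((Category.id_comp _).trans (((congrArg q.map (P.d_eq _)).trans (q.map_comp _ _)).symm.trans
      (Category.comp_id _).symm)))

lemma isZero_rightDerived_succ_iff {q : A ⥤ C} {t : C ⥤ A} [t.PreservesZeroMorphisms] (adj : q ⊣ t)
    {G : ObjectProperty C} {X : C} (I : Coresolution E G X) (k : ℕ) :
    IsZero (rightDerived t I (k + 1)) ↔ Epi (t.map (I.p k)) := by
  have h₁ : Mono (t.map (I.i (k + 1))) := mono_map_of_rightAdjoint adj (I.conf (k + 1))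
  have h₂ : Mono (t.map (I.i (k + 2))) := mono_map_of_rightAdjoint adj (I.conf (k + 2))
  rw [rightDerived, ← HomologicalComplex.exactAt_iff_isZero_homology,
    HomologicalComplex.exactAt_iff' _ k (k + 1) (k + 2) (by simp) (by simp),
    ← exact_iff_epi_of_mono (t.map (I.p k)) (t.map (I.i (k + 1))) (t.map (I.p (k + 1)))
      (t.map (I.i (k + 2))) (by rw [← t.map_comp, I.w, t.map_zero])
      (exact_map_of_rightAdjoint adj (I.conf (k + 1)))
      (by simp only [← t.map_comp, Category.assoc, reassoc_of% (I.w (k + 1))]; simp)]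
  exact ShortComplex.exact_iff_of_iso (ShortComplex.isoMk (Iso.refl _) (Iso.refl _) (Iso.refl _)
    ((Category.id_comp _).trans (((congrArg t.map (I.d_eq _)).trans (t.map_comp _ _)).symm.trans
      (Category.comp_id _).symm))
    ((Category.id_comp _).trans (((congrArg t.map (I.d_eq _)).trans (t.map_comp _ _)).symm.trans
      (Category.comp_id _).symm)))

end DerivedFunctors

section Comparison

open Opposite

theorem isZero_leftDerived_iff_thetaSucc_bijective {𝒞 : Type u} [Category.{v} 𝒞] [Preadditive 𝒞]
    [HasZeroObject 𝒞] [HasBinaryBiproducts 𝒞] (E : ExactStructure 𝒞) {𝒟 : Type u'}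
    [Category.{v'} 𝒟] [Abelian 𝒟] {q : 𝒞 ⥤ 𝒟} {t : 𝒟 ⥤ 𝒞} [q.Additive] [t.Additive] (adj : q ⊣ t)
    (ht : IsExactFunctor (abelianStructure 𝒟) E t) {F : ObjectProperty 𝒞} (hF : IsResolving E F)
    (hq : IsExactOn E (abelianStructure 𝒟) q F) (n : ℕ) {X : 𝒞} (P : Resolution E F X) :
    (∀ k < n, IsZero (leftDerived q P (k + 1))) ↔
      ∀ k < n, ∀ Y : 𝒟, Function.Bijective (thetaSucc adj ht k X Y) := by
  simp only [isZero_leftDerived_succ_iff adj]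
  exact mono_iff_thetaSucc_bijective adj ht hF hq
    (fun S hS hm => { exact := exact_map_of_leftAdjoint adj hS
                      mono_f := hm
                      epi_g := epi_map_of_leftAdjoint adj hS })
    n X P.Z (fun k => ⟨_, _, _, _, P.conf k⟩) P.mem P.iso

theorem isZero_rightDerived_iff_omegaSucc_bijective {𝒞 : Type u} [Category.{v} 𝒞] [Abelian 𝒞]
    {𝒟 : Type u'} [Category.{v'} 𝒟] [Preadditive 𝒟] [HasZeroObject 𝒟] [HasBinaryBiproducts 𝒟]
    (E' : ExactStructure 𝒟) {q : 𝒞 ⥤ 𝒟} {t : 𝒟 ⥤ 𝒞} [q.Additive] [t.Additive] (adj : q ⊣ t)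
    (hq : IsExactFunctor (abelianStructure 𝒞) E' q) {G : ObjectProperty 𝒟}
    (hG : IsCoresolving E' G) (ht : IsExactOn E' (abelianStructure 𝒞) t G) (n : ℕ) {Y : 𝒟}
    (I : Coresolution E' G Y) :
    (∀ k < n, IsZero (rightDerived t I (k + 1))) ↔
      ∀ k < n, ∀ X : 𝒞, Function.Bijective (omegaSucc adj hq k X Y) := by
  have : HasBinaryBiproducts 𝒟ᵒᵖ := HasBinaryBiproducts.of_hasBinaryProducts
  simp only [isZero_rightDerived_succ_iff adj, omegaSucc_bijective_iff]
  have h := mono_iff_thetaSucc_bijective adj.op hq.op hG.op ht.op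
    (fun S hS hm => { exact := exact_map_of_rightAdjoint adj (S := S.unop) hS
                      mono_f := mono_map_of_rightAdjoint adj (S := S.unop) hS
                      epi_g :=
                        have : Mono (t.map S.f.unop).op := hm
                        unop_epi_of_mono (t.map S.f.unop).op })
    n (op Y) (fun k => op (I.Z k)) (fun k => Extension.op ⟨_, _, _, _, I.conf k⟩) I.mem I.iso.symm.op
  refine Iff.trans (forall₂_congr fun k _ => ?_) (h.trans (forall₂_congr fun k _ => ?_))
  · exact ⟨fun _ => inferInstanceAs (Mono (t.map (I.p k)).op), fun h =>
      have : Mono (t.map (I.p k)).op := h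
      unop_epi_of_mono (t.map (I.p k)).op⟩
  · exact ⟨fun h X => h (op X), fun h X => h X.unop⟩

end Comparison

end ExactCat

-- `thetaSucc adj ht k C Y` is `Θ^{k+1}_{CY}` and `omegaSucc adj hq k X D` is `Ω^{k+1}_{XD}`, so the
-- quantifier `∀ k < n` at index `k + 1` ranges over the degrees `1, …, n`.
theorem proposition2p15 :
    (∀ (𝒞 : Type u) [Category.{v} 𝒞] [Preadditive 𝒞] [HasZeroObject 𝒞] [HasBinaryBiproducts 𝒞]
        (_ : ExactCat.WeaklyIdempotentComplete 𝒞) (E : ExactCat.ExactStructure 𝒞)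
        (𝒟 : Type u') [Category.{v'} 𝒟] [Abelian 𝒟]
        (q : 𝒞 ⥤ 𝒟) (t : 𝒟 ⥤ 𝒞) [q.Additive] [t.Additive] (adj : q ⊣ t)
        (ht : ExactCat.IsExactFunctor (ExactCat.abelianStructure 𝒟) E t)
        (F : ObjectProperty 𝒞) (_ : ExactCat.IsResolving E F)
        (_ : ExactCat.IsExactOn E (ExactCat.abelianStructure 𝒟) q F)
        (n : ℕ) (_ : 1 ≤ n) (C : 𝒞) (P : ExactCat.Resolution E F C),
        (∀ k < n, IsZero (ExactCat.leftDerived q P (k + 1))) ↔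
          ∀ k < n, ∀ Y : 𝒟, Function.Bijective (ExactCat.thetaSucc adj ht k C Y)) ∧
    (∀ (𝒞 : Type u) [Category.{v} 𝒞] [Abelian 𝒞]
        (𝒟 : Type u') [Category.{v'} 𝒟] [Preadditive 𝒟] [HasZeroObject 𝒟] [HasBinaryBiproducts 𝒟]
        (_ : ExactCat.WeaklyIdempotentComplete 𝒟) (E' : ExactCat.ExactStructure 𝒟)
        (q : 𝒞 ⥤ 𝒟) (t : 𝒟 ⥤ 𝒞) [q.Additive] [t.Additive] (adj : q ⊣ t)
        (hq : ExactCat.IsExactFunctor (ExactCat.abelianStructure 𝒞) E' q)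
        (G : ObjectProperty 𝒟) (_ : ExactCat.IsCoresolving E' G)
        (_ : ExactCat.IsExactOn E' (ExactCat.abelianStructure 𝒞) t G)
        (n : ℕ) (_ : 1 ≤ n) (D : 𝒟) (I : ExactCat.Coresolution E' G D),
        (∀ k < n, IsZero (ExactCat.rightDerived t I (k + 1))) ↔
          ∀ k < n, ∀ X : 𝒞, Function.Bijective (ExactCat.omegaSucc adj hq k X D)) := by
  refine ⟨?_, ?_⟩
  · intro 𝒞 _ _ _ _ _ E 𝒟 _ _ q t _ _ adj ht F hF hq n _ C P
    exact ExactCat.isZero_leftDerived_iff_thetaSucc_bijective E adj ht hF hq n P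
  · intro 𝒞 _ _ 𝒟 _ _ _ _ _ E' q t _ _ adj hq G hG ht n _ D I
    exact ExactCat.isZero_rightDerived_iff_omegaSucc_bijective E' adj hq hG ht n I
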